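/- Let $\mathcal T=(0,T)$, let $\mathcal D=(x_1,x_2)\times(y_1,y_2)$ be a rectangle, let $\Omega^+=\{(\xi,\eta):\xi,\eta>0,\ \xi^2+\eta^2=1\}$ with arc length measure $\mathrm d\boldsymbol v$, and put $\langle g\rangle=\frac2\pi\int_{\Omega^+}g\,\mathrm d\boldsymbol v$. Fix $\varepsilon>0$ and weights $\lambda_1,\dots,\lambda_4\in\mathbb R$. For functions $\rho(t,x,y)$ and $\varphi,j_1,j_2,w$ of $(t,x,y,\xi,\eta)$ write $F=\xi\partial_x(j_1+j_2)+\eta\partial_y(j_2-j_1)$ and $$\begin{aligned} d^{(1)}&=2\partial_t\rho+\langle F\rangle,\\ d^{(2)}&=2\varepsilon^2\partial_t w+F-\langle F\rangle+2w,\\ d^{(3)}&=\partial_t\varphi+\xi\partial_x(j_2-j_1)+\eta\partial_y(j_1+j_2)+\varepsilon^{-2}\varphi,\\ d^{(4)}&=\varepsilon^2\partial_t(j_1+j_2)+(j_1+j_2)+2\xi\partial_x(\rho+\varepsilon^2w)+\eta\partial_y\varphi,\\ d^{(5)}&=\varepsilon^2\partial_t(j_2-j_1)+(j_2-j_1)+\xi\partial_x\varphi+2\eta\partial_y(\rho+\varepsilon^2w).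 \end{aligned}$$ Let $\rho\in H^2(\mathcal T\times\mathcal D)$ and $\varphi,j_1,j_2,w\in H^2(\mathcal T\times\mathcal D\times\Omega^+)$ be an exact solution of the multiscale parity system, i.e. $d^{(1)}=\varepsilon^2d^{(3)}=0$, $d^{(2)}=d^{(4)}=d^{(5)}=0$ almost everywhere (weak derivatives) and $\langle w\rangle=0$. Let $\rho_{\rm IC},\varphi_{\rm IC},j_{1,\rm IC},j_{2,\rm IC},w_{\rm IC}$ be its initial values (traces at $t=0$), and let $\rho_{\rm BC},\varphi_{\rm BC},j_{1,\rm BC},j_{2,\rm BC},w_{\rm BC}$ be its boundary values (traces for $(x,y)\in\partial\mathcal D$). For approximations $\rho_\theta,\varphi_\theta,j_{1,\theta},j_{2,\theta},w_\theta$ let $d^{(k)}_\theta$ be the expressions above formed with them, and let the APNN loss be $\mathcal R^\varepsilon_{\rm APNN}=\mathcal R^\varepsilon_{\rm residual}+\mathcal R^\varepsilon_{\rm initial}+\mathcal R^\varepsilon_{\rm boundary}$, where $$\mathcal R^\varepsilon_{\rm residual}=\frac1{|\mathcal T\times\mathcal D|}\int_{\mathcal T}\!\int_{\mathcal D}|d^{(1)}_\theta|^2\,\mathrm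 d\boldsymbol x\,\mathrm dt+\frac1{|\mathcal T\times\mathcal D\times\Omega^+|}\sum_{k=2}^5\int_{\mathcal T}\!\int_{\mathcal D}\!\int_{\Omega^+}|d^{(k)}_\theta|^2\,\mathrm d\boldsymbol v\,\mathrm d\boldsymbol x\,\mathrm dt,$$ $$\begin{aligned}\mathcal R^\varepsilon_{\rm initial}={}&\frac{\lambda_1}{|\mathcal D|}\int_{\mathcal D}|\rho_\theta-\rho_{\rm IC}|^2\,\mathrm d\boldsymbol x+\frac{\lambda_2}{|\mathcal D\times\Omega^+|}\int_{\mathcal D}\!\int_{\Omega^+}\Big(\varepsilon^4|w_\theta-w_{\rm IC}|^2+|\varphi_\theta-\varphi_{\rm IC}|^2\\&+\varepsilon^2|(j_{1,\theta}+j_{2,\theta})-(j_{1,\rm IC}+j_{2,\rm IC})|^2+\varepsilon^2|(j_{2,\theta}-j_{1,\theta})-(j_{2,\rm IC}-j_{1,\rm IC})|^2\Big)\mathrm d\boldsymbol v\,\mathrm d\boldsymbol x\end{aligned}$$ (approximations evaluated at $t=0$), and $$\begin{aligned}\mathcal R^\varepsilon_{\rm boundary}={}&\frac{\lambda_3}{|\mathcal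 T\times\partial\mathcal D|}\int_{\mathcal T}\!\int_{\partial\mathcal D}|\rho_\theta-\rho_{\rm BC}|^2\,\mathrm ds\,\mathrm dt+\frac{\lambda_4}{|\mathcal T\times\partial\mathcal D\times\Omega^+|}\int_{\mathcal T}\!\int_{\partial\mathcal D}\!\int_{\Omega^+}\Big(|w_\theta-w_{\rm BC}|^2+|\varphi_\theta-\varphi_{\rm BC}|^2\\&+|(j_{1,\theta}+j_{2,\theta})-(j_{1,\rm BC}+j_{2,\rm BC})|^2+|(j_{2,\theta}-j_{1,\theta})-(j_{2,\rm BC}-j_{1,\rm BC})|^2\Big)\mathrm d\boldsymbol v\,\mathrm ds\,\mathrm dt.\end{aligned}$$ Then for every integer $N\ge0$ (in particular every $N>5$) there are $\tanh$ neural networks $\hat\rho^N$ (with input $(t,x,y)$) and $\hat\varphi^N,\hat j_1^N,\hat j_2^N,\hat w^N$ (with input $(t,x,y,\xi,\eta)$), each with two hidden layers whose width depends only on $N$, such that the loss of $(\rho_\theta,\varphi_\theta,j_{1,\theta},j_{2,\theta},w_\theta)=(\hat\rho^N,\hat\varphi^N,\hat j_1^N,\hat j_2^N,\hat w^N)$ satisfies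 $$\mathcal R^\varepsilon_{\rm APNN}\to0\qquad\text{as }N\to\infty .$$ -/

import Mathlib

open MeasureTheory Filter Topology Set
open scoped ContDiff Matrix

namespace ParityAPNN

/-! ### Sobolev functions on open sets of `ℝⁿ` -/

/-- The classical partial derivative `∂ᵢ u`. -/
noncomputable def partialDeriv {n : ℕ} (i : Fin n) (u : (Fin n → ℝ) → ℝ) (z : Fin n → ℝ) : ℝ :=
  fderiv ℝ u z (Pi.single i 1)

/-- `v` is the weak `i`-th partial derivative of `u` on `U`. -/
structure HasWeakPartial {n : ℕ} (U : Set (Fin n → ℝ)) (i : Fin n)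
    (u v : (Fin n → ℝ) → ℝ) : Prop where
  locInt : LocallyIntegrableOn u U
  locInt_deriv : LocallyIntegrableOn v U
  integral_eq : ∀ ψ : (Fin n → ℝ) → ℝ, ContDiff ℝ ∞ ψ → HasCompactSupport ψ → tsupport ψ ⊆ U →
    ∫ z in U, u z * partialDeriv i ψ z = -∫ z in U, v z * ψ z

/-- The Sobolev space `Hᵏ(U) = W^{k,2}(U)`. -/
def MemH {n : ℕ} (U : Set (Fin n → ℝ)) : ℕ → ((Fin n → ℝ) → ℝ) → Prop
  | 0, u => MemLp u 2 (volume.restrict U)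
  | k + 1, u => MemLp u 2 (volume.restrict U) ∧
      ∀ i : Fin n, ∃ v, HasWeakPartial U i u v ∧ MemH U k v

open Classical in
/-- A version of the weak partial derivative of `u` on `U` (unique up to null sets when it exists;
by convention `0` when it does not). -/
noncomputable def weakPartial {n : ℕ} (U : Set (Fin n → ℝ)) (i : Fin n)
    (u : (Fin n → ℝ) → ℝ) : (Fin n → ℝ) → ℝ :=
  if h : ∃ v, HasWeakPartial U i u v then h.choose else 0

theorem hasWeakPartial_weakPartial {n : ℕ} {U : Set (Fin n → ℝ)} {i : Fin n}
    {u v : (Fin n → ℝ) → ℝ} (h : HasWeakPartial U i u v) :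
    HasWeakPartial U i u (weakPartial U i u) := by
  have hex : ∃ v, HasWeakPartial U i u v := ⟨v, h⟩
  unfold weakPartial
  rw [dif_pos hex]
  exact hex.choose_spec

/-! ### Boxes, their faces, and traces -/

/-- The open box `∏ᵢ (loᵢ, hiᵢ)`. -/
def openBox {n : ℕ} (lo hi : Fin n → ℝ) : Set (Fin n → ℝ) :=
  Set.univ.pi fun i => Ioo (lo i) (hi i)

/-- The (relatively open) faces of the box orthogonal to the `i`-th axis, described by the
remaining coordinates. -/
def face {n : ℕ} (lo hi : Fin (n + 1) → ℝ) (i : Fin (n + 1)) : Set (Fin n → ℝ) :=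
  openBox (i.removeNth lo) (i.removeNth hi)

/-- The point of the hyperplane `zᵢ = c` whose remaining coordinates are `y`. -/
def onPlane {n : ℕ} (i : Fin (n + 1)) (c : ℝ) (y : Fin n → ℝ) : Fin (n + 1) → ℝ :=
  Fin.insertNth (α := fun _ => ℝ) i c y

/-- The function `g ∈ L²` is the trace of `u` on the face `zᵢ = c` (with `c = loᵢ` or `c = hiᵢ`)
of the box: `h⁻¹ ∫_{|zᵢ - c| < h} |u(z) - g(z')|² dz → 0` as `h → 0⁺`, where `z'` is the projection
of `z` to the face, i.e. the slices of `u` parallel to the face converge to `g` in `L²`. For `u` in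
`H¹` of the box there is exactly one such `g`, up to null sets. -/
structure HasFaceTrace {n : ℕ} (lo hi : Fin (n + 1) → ℝ) (i : Fin (n + 1)) (c : ℝ)
    (u : (Fin (n + 1) → ℝ) → ℝ) (g : (Fin n → ℝ) → ℝ) : Prop where
  memLp : MemLp g 2 (volume.restrict (face lo hi i))
  tendsto : Tendsto
    (fun h : ℝ => h⁻¹ * ∫ z in openBox lo hi ∩ {z | |z i - c| < h}, |u z - g (i.removeNth z)| ^ 2)
    (𝓝[>] 0) (𝓝 0)

/-- The coordinates are `(t, x, y)` or `(t, x, y, θ)`. The function `g`, read only on the lateral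
boundary `𝒯 × ∂𝒟` (`× Ω⁺`), is the trace of `u` there, i.e. on the four faces where `x` or `y` takes
an extreme value. -/
def HasLateralTrace {n : ℕ} (lo hi : Fin (n + 1) → ℝ) (u g : (Fin (n + 1) → ℝ) → ℝ) : Prop :=
  ∀ i : Fin (n + 1), i = 1 ∨ i = 2 →
    HasFaceTrace lo hi i (lo i) u (fun y => g (onPlane i (lo i) y)) ∧
    HasFaceTrace lo hi i (hi i) u (fun y => g (onPlane i (hi i) y))

/-- The integral of `G` over the face `zᵢ = c`. -/
noncomputable def faceIntegral {n : ℕ} (lo hi : Fin (n + 1) → ℝ) (i : Fin (n + 1)) (c : ℝ)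
    (G : (Fin (n + 1) → ℝ) → ℝ) : ℝ :=
  ∫ y in face lo hi i, G (onPlane i c y)

/-- The integral of `G` over the lateral boundary `𝒯 × ∂𝒟` (`× Ω⁺`). -/
noncomputable def lateralIntegral {n : ℕ} (lo hi : Fin (n + 1) → ℝ)
    (G : (Fin (n + 1) → ℝ) → ℝ) : ℝ :=
  faceIntegral lo hi 1 (lo 1) G + faceIntegral lo hi 1 (hi 1) G +
    faceIntegral lo hi 2 (lo 2) G + faceIntegral lo hi 2 (hi 2) G

/-! ### The domain and the unknowns -/

/-- The time interval `𝒯 = (0, T)` and the spatial rectangle `𝒟 = (x₁, x₂) × (y₁, y₂)`. -/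
structure Domain where
  T : ℝ
  x₁ : ℝ
  x₂ : ℝ
  y₁ : ℝ
  y₂ : ℝ
  T_pos : 0 < T
  x_lt : x₁ < x₂
  y_lt : y₁ < y₂

namespace Domain

/-- Lower corner of `𝒯 × 𝒟`, coordinates `(t, x, y)`. -/
def lo (Q : Domain) : Fin 3 → ℝ := ![0, Q.x₁, Q.y₁]

/-- Upper corner of `𝒯 × 𝒟`. -/
def hi (Q : Domain) : Fin 3 → ℝ := ![Q.T, Q.x₂, Q.y₂]

/-- Lower corner of `𝒯 × 𝒟 × Ω⁺`, coordinates `(t, x, y, θ)`: the open quarter circle `Ω⁺` is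
parametrized by its arc length `θ ∈ (0, π/2)`, with `(ξ, η) = (cos θ, sin θ)`. -/
noncomputable def loV (Q : Domain) : Fin 4 → ℝ := ![0, Q.x₁, Q.y₁, 0]

/-- Upper corner of `𝒯 × 𝒟 × Ω⁺`. -/
noncomputable def hiV (Q : Domain) : Fin 4 → ℝ := ![Q.T, Q.x₂, Q.y₂, Real.pi / 2]

/-- `𝒯 × 𝒟`. -/
def macro₃ (Q : Domain) : Set (Fin 3 → ℝ) := openBox Q.lo Q.hi

/-- `𝒯 × 𝒟 × Ω⁺`. -/
noncomputable def kinetic₄ (Q : Domain) : Set (Fin 4 → ℝ) := openBox Q.loV Q.hiV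

end Domain

/-- A quintuple `(ρ, φ, j₁, j₂, w)`, where `ρ` depends on `n` variables and the other functions
depend on the angle `θ` as an additional last variable. For `n = 3` the variables are `(t, x, y)`,
for `n = 2` (initial data) they are `(x, y)`. -/
structure Fields (n : ℕ) where
  ρ : (Fin n → ℝ) → ℝ
  φ : (Fin (n + 1) → ℝ) → ℝ
  j₁ : (Fin (n + 1) → ℝ) → ℝ
  j₂ : (Fin (n + 1) → ℝ) → ℝ
  w : (Fin (n + 1) → ℝ) → ℝ

/-- The velocity average `⟨g⟩ = (2/π) ∫_{Ω⁺} g dv`. -/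
noncomputable def velAvg (g : (Fin 4 → ℝ) → ℝ) (p : Fin 3 → ℝ) : ℝ :=
  2 / Real.pi * ∫ θ in Ioo 0 (Real.pi / 2), g (Fin.snoc (α := fun _ => ℝ) p θ)

/-! ### The parity system

The five left-hand sides are written for given partial derivative operators `D₃` (on functions of
`(t, x, y)`) and `D₄` (on functions of `(t, x, y, θ)`): weak derivatives for the exact solution,
classical derivatives for the smooth neural networks. -/

/-- A family of first-order partial derivative operators. -/
abbrev Derivs (n : ℕ) := Fin n → ((Fin n → ℝ) → ℝ) → (Fin n → ℝ) → ℝ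

/-- `ξ ∂ₓ(j₁ + j₂) + η ∂ᵧ(j₂ - j₁)`. -/
noncomputable def flux (D₄ : Derivs 4) (s : Fields 3) (z : Fin 4 → ℝ) : ℝ :=
  Real.cos (z 3) * (D₄ 1 s.j₁ z + D₄ 1 s.j₂ z) + Real.sin (z 3) * (D₄ 2 s.j₂ z - D₄ 2 s.j₁ z)

/-- `2 ∂ₜρ + ⟨ξ ∂ₓ(j₁ + j₂) + η ∂ᵧ(j₂ - j₁)⟩`. -/
noncomputable def residual₁ (D₃ : Derivs 3) (D₄ : Derivs 4) (s : Fields 3) (p : Fin 3 → ℝ) : ℝ :=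
  2 * D₃ 0 s.ρ p + velAvg (flux D₄ s) p

/-- `2ε² ∂ₜw + (ξ ∂ₓ(j₁ + j₂) + η ∂ᵧ(j₂ - j₁)) - ⟨ξ ∂ₓ(j₁ + j₂) + η ∂ᵧ(j₂ - j₁)⟩ + 2w`. -/
noncomputable def residual₂ (ε : ℝ) (D₄ : Derivs 4) (s : Fields 3) (z : Fin 4 → ℝ) : ℝ :=
  2 * ε ^ 2 * D₄ 0 s.w z + flux D₄ s z - velAvg (flux D₄ s) (Fin.init z) + 2 * s.w z

/-- `∂ₜφ + ξ ∂ₓ(j₂ - j₁) + η ∂ᵧ(j₁ + j₂) + ε⁻² φ`. -/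
noncomputable def residual₃ (ε : ℝ) (D₄ : Derivs 4) (s : Fields 3) (z : Fin 4 → ℝ) : ℝ :=
  D₄ 0 s.φ z + Real.cos (z 3) * (D₄ 1 s.j₂ z - D₄ 1 s.j₁ z)
    + Real.sin (z 3) * (D₄ 2 s.j₁ z + D₄ 2 s.j₂ z) + 1 / ε ^ 2 * s.φ z

/-- `ε² ∂ₜ(j₁ + j₂) + (j₁ + j₂) + 2ξ ∂ₓ(ρ + ε² w) + η ∂ᵧφ`. -/
noncomputable def residual₄ (ε : ℝ) (D₃ : Derivs 3) (D₄ : Derivs 4) (s : Fields 3)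
    (z : Fin 4 → ℝ) : ℝ :=
  ε ^ 2 * (D₄ 0 s.j₁ z + D₄ 0 s.j₂ z) + (s.j₁ z + s.j₂ z)
    + 2 * Real.cos (z 3) * (D₃ 1 s.ρ (Fin.init z) + ε ^ 2 * D₄ 1 s.w z)
    + Real.sin (z 3) * D₄ 2 s.φ z

/-- `ε² ∂ₜ(j₂ - j₁) + (j₂ - j₁) + ξ ∂ₓφ + 2η ∂ᵧ(ρ + ε² w)`. -/
noncomputable def residual₅ (ε : ℝ) (D₃ : Derivs 3) (D₄ : Derivs 4) (s : Fields 3)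
    (z : Fin 4 → ℝ) : ℝ :=
  ε ^ 2 * (D₄ 0 s.j₂ z - D₄ 0 s.j₁ z) + (s.j₂ z - s.j₁ z)
    + Real.cos (z 3) * D₄ 1 s.φ z
    + 2 * Real.sin (z 3) * (D₃ 2 s.ρ (Fin.init z) + ε ^ 2 * D₄ 2 s.w z)

/-- All five components are `H²`: `ρ ∈ H²(𝒯 × 𝒟)` and `φ, j₁, j₂, w ∈ H²(𝒯 × 𝒟 × Ω⁺)`. -/
structure IsH2 (Q : Domain) (s : Fields 3) : Prop where
  ρ : MemH Q.macro₃ 2 s.ρ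
  φ : MemH Q.kinetic₄ 2 s.φ
  j₁ : MemH Q.kinetic₄ 2 s.j₁
  j₂ : MemH Q.kinetic₄ 2 s.j₂
  w : MemH Q.kinetic₄ 2 s.w

/-- `s` solves the multiscale parity system with Knudsen number `ε`, almost everywhere, together
with the constraint `⟨w⟩ = 0`. -/
structure IsParitySolution (Q : Domain) (ε : ℝ) (s : Fields 3) : Prop where
  eq₁ : ∀ᵐ p ∂volume.restrict Q.macro₃,
    residual₁ (weakPartial Q.macro₃) (weakPartial Q.kinetic₄) s p = 0
  eq₂ : ∀ᵐ z ∂volume.restrict Q.kinetic₄, residual₂ ε (weakPartial Q.kinetic₄) s z = 0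
  eq₃ : ∀ᵐ z ∂volume.restrict Q.kinetic₄, ε ^ 2 * residual₃ ε (weakPartial Q.kinetic₄) s z = 0
  eq₄ : ∀ᵐ z ∂volume.restrict Q.kinetic₄,
    residual₄ ε (weakPartial Q.macro₃) (weakPartial Q.kinetic₄) s z = 0
  eq₅ : ∀ᵐ z ∂volume.restrict Q.kinetic₄,
    residual₅ ε (weakPartial Q.macro₃) (weakPartial Q.kinetic₄) s z = 0
  avg_w : ∀ᵐ p ∂volume.restrict Q.macro₃, velAvg s.w p = 0

/-- `ic` consists of the initial values (at `t = 0`) of `s`, in the sense of traces. -/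
structure HasInitialData (Q : Domain) (s : Fields 3) (ic : Fields 2) : Prop where
  ρ : HasFaceTrace Q.lo Q.hi 0 0 s.ρ ic.ρ
  φ : HasFaceTrace Q.loV Q.hiV 0 0 s.φ ic.φ
  j₁ : HasFaceTrace Q.loV Q.hiV 0 0 s.j₁ ic.j₁
  j₂ : HasFaceTrace Q.loV Q.hiV 0 0 s.j₂ ic.j₂
  w : HasFaceTrace Q.loV Q.hiV 0 0 s.w ic.w

/-- `bc` consists of the boundary values (for `(x, y) ∈ ∂𝒟`) of `s`, in the sense of traces. -/
structure HasBoundaryData (Q : Domain) (s bc : Fields 3) : Prop where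
  ρ : HasLateralTrace Q.lo Q.hi s.ρ bc.ρ
  φ : HasLateralTrace Q.loV Q.hiV s.φ bc.φ
  j₁ : HasLateralTrace Q.loV Q.hiV s.j₁ bc.j₁
  j₂ : HasLateralTrace Q.loV Q.hiV s.j₂ bc.j₂
  w : HasLateralTrace Q.loV Q.hiV s.w bc.w

/-! ### The loss function -/

/-- The residual part of the loss, for smooth fields `s`. -/
noncomputable def lossResidual (Q : Domain) (ε : ℝ) (s : Fields 3) : ℝ :=
  1 / volume.real Q.macro₃ * (∫ p in Q.macro₃, |residual₁ partialDeriv partialDeriv s p| ^ 2) +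
  1 / volume.real Q.kinetic₄ *
    ((∫ z in Q.kinetic₄, |residual₂ ε partialDeriv s z| ^ 2) +
     (∫ z in Q.kinetic₄, |residual₃ ε partialDeriv s z| ^ 2) +
     (∫ z in Q.kinetic₄, |residual₄ ε partialDeriv partialDeriv s z| ^ 2) +
     (∫ z in Q.kinetic₄, |residual₅ ε partialDeriv partialDeriv s z| ^ 2))

/-- The initial part of the loss: integrals over `𝒟` and `𝒟 × Ω⁺` at time `t = 0`. -/
noncomputable def lossInitial (Q : Domain) (ε lam₁ lam₂ : ℝ) (ic : Fields 2) (s : Fields 3) : ℝ :=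
  lam₁ / volume.real (face Q.lo Q.hi 0) *
    (∫ q in face Q.lo Q.hi 0, |s.ρ (onPlane 0 0 q) - ic.ρ q| ^ 2) +
  lam₂ / volume.real (face Q.loV Q.hiV 0) *
    ∫ q in face Q.loV Q.hiV 0,
      (ε ^ 4 * |s.w (onPlane 0 0 q) - ic.w q| ^ 2 + |s.φ (onPlane 0 0 q) - ic.φ q| ^ 2
      + ε ^ 2 *
        (|(s.j₁ (onPlane 0 0 q) + s.j₂ (onPlane 0 0 q)) - (ic.j₁ q + ic.j₂ q)| ^ 2
        + |(s.j₂ (onPlane 0 0 q) - s.j₁ (onPlane 0 0 q)) - (ic.j₂ q - ic.j₁ q)| ^ 2))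

/-- The boundary part of the loss: integrals over `𝒯 × ∂𝒟` and `𝒯 × ∂𝒟 × Ω⁺`. -/
noncomputable def lossBoundary (Q : Domain) (lam₃ lam₄ : ℝ) (bc s : Fields 3) : ℝ :=
  lam₃ / lateralIntegral Q.lo Q.hi (fun _ => 1) *
    lateralIntegral Q.lo Q.hi (fun p => |s.ρ p - bc.ρ p| ^ 2) +
  lam₄ / lateralIntegral Q.loV Q.hiV (fun _ => 1) *
    lateralIntegral Q.loV Q.hiV (fun z =>
      |s.w z - bc.w z| ^ 2 + |s.φ z - bc.φ z| ^ 2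
      + |(s.j₁ z + s.j₂ z) - (bc.j₁ z + bc.j₂ z)| ^ 2
      + |(s.j₂ z - s.j₁ z) - (bc.j₂ z - bc.j₁ z)| ^ 2)

/-- The full loss, with penalty weights `lam 0, …, lam 3`. -/
noncomputable def lossAPNN (Q : Domain) (ε : ℝ) (lam : Fin 4 → ℝ) (ic : Fields 2) (bc : Fields 3)
    (s : Fields 3) : ℝ :=
  lossResidual Q ε s + lossInitial Q ε (lam 0) (lam 1) ic s +
    lossBoundary Q (lam 2) (lam 3) bc s

/-! ### Neural networks -/

/-- The parameters of a scalar neural network with `d` inputs and two hidden layers of `m` neurons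
each. -/
structure TanhNet (d m : ℕ) where
  W₁ : Matrix (Fin m) (Fin d) ℝ
  b₁ : Fin m → ℝ
  W₂ : Matrix (Fin m) (Fin m) ℝ
  b₂ : Fin m → ℝ
  W₃ : Fin m → ℝ
  b₃ : ℝ

/-- The function realized by the network, with activation `tanh`. -/
noncomputable def TanhNet.eval {d m : ℕ} (A : TanhNet d m) (x : Fin d → ℝ) : ℝ :=
  A.W₃ ⬝ᵥ (fun k => Real.tanh ((A.W₂ *ᵥ (fun l => Real.tanh ((A.W₁ *ᵥ x + A.b₁) l)) + A.b₂) k))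
    + A.b₃

/-- The point `(t, x, y, ξ, η)` with coordinates `(t, x, y, θ)`. -/
noncomputable def withVelocity (z : Fin 4 → ℝ) : Fin 5 → ℝ :=
  ![z 0, z 1, z 2, Real.cos (z 3), Real.sin (z 3)]

/-- Five networks of width `m` approximating `(ρ, φ, j₁, j₂, w)`; the first has the input
`(t, x, y)`, the others `(t, x, y, ξ, η)`. -/
structure APNNet (m : ℕ) where
  ρ : TanhNet 3 m
  φ : TanhNet 5 m
  j₁ : TanhNet 5 m
  j₂ : TanhNet 5 m
  w : TanhNet 5 m

/-- The functions realized by the five networks. -/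
noncomputable def APNNet.fields {m : ℕ} (A : APNNet m) : Fields 3 where
  ρ := A.ρ.eval
  φ := fun z => A.φ.eval (withVelocity z)
  j₁ := fun z => A.j₁.eval (withVelocity z)
  j₂ := fun z => A.j₂.eval (withVelocity z)
  w := fun z => A.w.eval (withVelocity z)

end ParityAPNN

open ParityAPNN

/-! The exact solution annihilates every residual and matches its own traces, and the system is
linear. For fixed ε the loss is therefore a finite combination of integrals of squares of errors:
first derivatives, values, velocity averages and traces of the difference between networks and
solution. All of these are controlled by the `H¹` norm, so it suffices to approximate each component
in `H¹` of its box by two-layer networks.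

Density in `H¹` is proved in two stages. First, cosine polynomials are dense
(`exists_cosAlg_H1_close`). In the Hilbert space of jets (a function with candidate derivatives, all
in `L²`), the weak derivative identities cut out a closed subspace containing the cosine jets. A
weak jet orthogonal to all of these is zero. Indeed a cosine mode is a Neumann eigenfunction, so
integration by parts leaves no boundary term and turns orthogonality into `(1 + ∑ⱼ (kⱼπ/Lⱼ)²) ∫ u cₖ
= 0`, where `cₖ` is the mode and `Lⱼ` are the side lengths. Thus all cosine coefficients of `u`
vanish, and `u = 0` by completeness (Stone–Weierstrass). No extension or mollification up to the
boundary is needed.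

Second, cosine polynomials are `C¹` limits of networks on the closed box
(`adjoin_le_closure_netSpan`). A second layer can imitate the identity, the tail of a shifted `tanh`
is an exponential, and exponentials of linear forms span an algebra. The `C¹` closure of that
algebra contains the coordinates, hence polynomials in them, hence all `C¹` functions of a single
feature and their products. The angular modes fit this pattern because `cos 2kθ` is a Chebyshev
polynomial in `ξ = cos θ` (`Domain.exists_feature`).

Traces are handled by an estimate on thin slabs (`trace_estimate_slab`). Velocity averages are
handled by Fubini and Cauchy–Schwarz. Finally, a sequence of networks of uncontrolled widths is
slowed down until the `N`-th one has width `N` (`exists_net_of_width`). -/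

namespace ParityAPNN

/-! ### Calculus of classical partial derivatives -/

section PartialDeriv

variable {n : ℕ} {f g : (Fin n → ℝ) → ℝ} {i : Fin n} {z : Fin n → ℝ}

theorem partialDeriv_add (hf : DifferentiableAt ℝ f z) (hg : DifferentiableAt ℝ g z) :
    partialDeriv i (f + g) z = partialDeriv i f z + partialDeriv i g z := by
  simp [partialDeriv, fderiv_add hf hg]

theorem partialDeriv_smul (c : ℝ) (hf : DifferentiableAt ℝ f z) :
    partialDeriv i (c • f) z = c * partialDeriv i f z := by
  simp [partialDeriv, fderiv_const_smul hf]

theorem partialDeriv_mul (hf : DifferentiableAt ℝ f z) (hg : DifferentiableAt ℝ g z) :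
    partialDeriv i (f * g) z = f z * partialDeriv i g z + partialDeriv i f z * g z := by
  simp [partialDeriv, fderiv_mul hf hg, mul_comm]

theorem partialDeriv_comp {F : ℝ → ℝ} (hF : DifferentiableAt ℝ F (f z))
    (hf : DifferentiableAt ℝ f z) :
    partialDeriv i (F ∘ f) z = deriv F (f z) * partialDeriv i f z := by
  simp [partialDeriv, fderiv_comp z hF hf, mul_comm]

theorem continuous_partialDeriv (hf : ContDiff ℝ 1 f) (i : Fin n) :
    Continuous (partialDeriv i f) :=
  (hf.continuous_fderiv one_ne_zero).clm_apply continuous_const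

end PartialDeriv

/-! ### `C¹` approximation on a set -/

/-- `f` and `g` are `δ`-close on `K`, together with their first partial derivatives. -/
def C1Close {n : ℕ} (K : Set (Fin n → ℝ)) (δ : ℝ) (f g : (Fin n → ℝ) → ℝ) : Prop :=
  ∀ z ∈ K, |f z - g z| ≤ δ ∧ ∀ i, |partialDeriv i f z - partialDeriv i g z| ≤ δ

theorem exists_C1_bound {n : ℕ} {K : Set (Fin n → ℝ)} (hK : IsCompact K)
    {f : (Fin n → ℝ) → ℝ} (hf : ContDiff ℝ 1 f) :
    ∃ M, 0 < M ∧ ∀ z ∈ K, |f z| ≤ M ∧ ∀ i, |partialDeriv i f z| ≤ M := by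
  obtain ⟨M₀, h₀⟩ := hK.exists_bound_of_continuousOn hf.continuous.continuousOn
  choose M h using fun i =>
    hK.exists_bound_of_continuousOn (continuous_partialDeriv hf i).continuousOn
  refine ⟨|M₀| + ∑ i, |M i| + 1, by positivity, fun z hz => ⟨?_, fun i => ?_⟩⟩
  · have h1 : 0 ≤ ∑ i, |M i| := by positivity
    have h2 := h₀ z hz
    rw [Real.norm_eq_abs] at h2
    linarith [le_abs_self M₀]
  · have h1 : |M i| ≤ ∑ i, |M i| :=
      Finset.single_le_sum (f := fun i => |M i|) (fun _ _ => abs_nonneg _) (Finset.mem_univ i)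
    have h2 := h i z hz
    rw [Real.norm_eq_abs] at h2
    linarith [le_abs_self (M i), abs_nonneg M₀]

/-- The `C¹` functions which are limits on `K`, in the `C¹` norm, of `C¹` functions in `S`. -/
def c1Closure {n : ℕ} (K : Set (Fin n → ℝ)) (S : Submodule ℝ ((Fin n → ℝ) → ℝ)) :
    Submodule ℝ ((Fin n → ℝ) → ℝ) where
  carrier := {f | ContDiff ℝ 1 f ∧ ∀ δ > 0, ∃ g ∈ S, ContDiff ℝ 1 g ∧ C1Close K δ f g}
  zero_mem' := ⟨contDiff_const, fun δ hδ => ⟨0, S.zero_mem, contDiff_const,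
    fun z _ => by simp [hδ.le]⟩⟩
  add_mem' := by
    rintro f₁ f₂ ⟨hf₁, h₁⟩ ⟨hf₂, h₂⟩
    refine ⟨hf₁.add hf₂, fun δ hδ => ?_⟩
    obtain ⟨g₁, hS₁, hg₁, hc₁⟩ := h₁ (δ / 2) (by positivity)
    obtain ⟨g₂, hS₂, hg₂, hc₂⟩ := h₂ (δ / 2) (by positivity)
    refine ⟨g₁ + g₂, S.add_mem hS₁ hS₂, hg₁.add hg₂, fun z hz => ⟨?_, fun i => ?_⟩⟩
    · have a := abs_le.1 (hc₁ z hz).1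
      have b := abs_le.1 (hc₂ z hz).1
      simp only [Pi.add_apply]
      rw [abs_le]; constructor <;> linarith [a.1, a.2, b.1, b.2]
    · rw [partialDeriv_add (hf₁.differentiable one_ne_zero z) (hf₂.differentiable one_ne_zero z),
        partialDeriv_add (hg₁.differentiable one_ne_zero z) (hg₂.differentiable one_ne_zero z)]
      have a := abs_le.1 ((hc₁ z hz).2 i)
      have b := abs_le.1 ((hc₂ z hz).2 i)
      rw [abs_le]; constructor <;> linarith [a.1, a.2, b.1, b.2]
  smul_mem' := by
    rintro c f ⟨hf, h⟩
    refine ⟨contDiff_const.smul hf, fun δ hδ => ?_⟩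
    have hc : 0 < |c| + 1 := by positivity
    obtain ⟨g, hS, hg, hcl⟩ := h (δ / (|c| + 1)) (by positivity)
    have key : ∀ a b : ℝ, |a - b| ≤ δ / (|c| + 1) → |c * a - c * b| ≤ δ := fun a b hab => by
      rw [← mul_sub, abs_mul]
      calc |c| * |a - b| ≤ (|c| + 1) * (δ / (|c| + 1)) := by gcongr; linarith
        _ = δ := by field_simp
    refine ⟨c • g, S.smul_mem c hS, contDiff_const.smul hg, fun z hz => ⟨?_, fun i => ?_⟩⟩
    · simpa using key _ _ (hcl z hz).1
    · rw [partialDeriv_smul c (hf.differentiable one_ne_zero z),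
        partialDeriv_smul c (hg.differentiable one_ne_zero z)]
      exact key _ _ ((hcl z hz).2 i)

section Closure

variable {n : ℕ} {K : Set (Fin n → ℝ)} {S : Submodule ℝ ((Fin n → ℝ) → ℝ)}

theorem mem_c1Closure {f : (Fin n → ℝ) → ℝ} (hf : ContDiff ℝ 1 f) (h : f ∈ S) :
    f ∈ c1Closure K S :=
  ⟨hf, fun δ hδ => ⟨f, h, hf, fun z _ => by simp [hδ.le]⟩⟩

/-- Two errors of size `δ / 2` add up. This allows approximations to be chained: each later step may
use functions that are themselves only limits of networks. -/
theorem c1Closure_c1Closure_le : c1Closure K (c1Closure K S) ≤ c1Closure K S := by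
  rintro f ⟨hf, h⟩
  refine ⟨hf, fun δ hδ => ?_⟩
  obtain ⟨g, ⟨-, hg'⟩, hg, hc⟩ := h (δ / 2) (by positivity)
  obtain ⟨k, hkS, hk, hc'⟩ := hg' (δ / 2) (by positivity)
  refine ⟨k, hkS, hk, fun z hz => ⟨?_, fun i => ?_⟩⟩
  · have a := abs_le.1 (hc z hz).1
    have b := abs_le.1 (hc' z hz).1
    rw [abs_le]; constructor <;> linarith [a.1, a.2, b.1, b.2]
  · have a := abs_le.1 ((hc z hz).2 i)
    have b := abs_le.1 ((hc' z hz).2 i)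
    rw [abs_le]; constructor <;> linarith [a.1, a.2, b.1, b.2]

theorem c1Closure_mono {S' : Submodule ℝ ((Fin n → ℝ) → ℝ)} (h : S ≤ S') :
    c1Closure K S ≤ c1Closure K S' := fun _ hf =>
  ⟨hf.1, fun δ hδ => (hf.2 δ hδ).imp fun _ hg => ⟨h hg.1, hg.2⟩⟩

theorem c1Closure_le_of_le {S' : Submodule ℝ ((Fin n → ℝ) → ℝ)} (h : S ≤ c1Closure K S') :
    c1Closure K S ≤ c1Closure K S' :=
  (c1Closure_mono h).trans c1Closure_c1Closure_le

/-- Only `a` and `b` are assumed bounded by `M`. The approximants `a'` and `b'` are eliminated by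
expanding around `a` and `b`, and `δ ≤ 1` absorbs the quadratic error. -/
theorem abs_mul_sub_mul_le {a b a' b' M δ : ℝ} (ha : |a - a'| ≤ δ) (hb : |b - b'| ≤ δ)
    (hM : |a| ≤ M) (hM' : |b| ≤ M) (hδ : δ ≤ 1) : |a * b - a' * b'| ≤ δ * (2 * M + 1) := by
  have hδ0 : 0 ≤ δ := (abs_nonneg _).trans ha
  have e : a * b - a' * b' = (a - a') * b + a * (b - b') - (a - a') * (b - b') := by ring
  rw [e]
  calc |(a - a') * b + a * (b - b') - (a - a') * (b - b')|
      ≤ |a - a'| * |b| + |a| * |b - b'| + |a - a'| * |b - b'| := by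
        rw [← abs_mul, ← abs_mul, ← abs_mul]
        exact (abs_sub _ _).trans (add_le_add_left (abs_add_le _ _) _)
    _ ≤ δ * M + M * δ + δ * 1 := by
        have : 0 ≤ M := (abs_nonneg _).trans hM
        gcongr
        exact hb.trans hδ
    _ = δ * (2 * M + 1) := by ring

theorem mul_mem_c1Closure (hK : IsCompact K) (hS : ∀ f ∈ S, ∀ g ∈ S, f * g ∈ S)
    {f g : (Fin n → ℝ) → ℝ} (hf : f ∈ c1Closure K S) (hg : g ∈ c1Closure K S) :
    f * g ∈ c1Closure K S := by
  obtain ⟨hf, hf'⟩ := hf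
  obtain ⟨hg, hg'⟩ := hg
  refine ⟨hf.mul hg, fun δ hδ => ?_⟩
  obtain ⟨M₁, hM₁, hb₁⟩ := exists_C1_bound hK hf
  obtain ⟨M₂, hM₂, hb₂⟩ := exists_C1_bound hK hg
  set M := max M₁ M₂ with hM
  have hM0 : 0 < M := lt_max_of_lt_left hM₁
  -- The product rule produces two products, each with error at most `δ' (2M + 1)`; hence the extra
  -- factor 2.
  set δ' := min 1 (δ / (2 * (2 * M + 1))) with hδ'
  have hδ'0 : 0 < δ' := lt_min one_pos (by positivity)
  have hδ'1 : δ' ≤ 1 := min_le_left _ _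
  have hδ'2 : δ' * (2 * M + 1) ≤ δ / 2 := by
    calc δ' * (2 * M + 1) ≤ δ / (2 * (2 * M + 1)) * (2 * M + 1) := by
          gcongr; exact min_le_right _ _
      _ = δ / 2 := by field_simp
  obtain ⟨p, hpS, hp, hcp⟩ := hf' δ' hδ'0
  obtain ⟨q, hqS, hq, hcq⟩ := hg' δ' hδ'0
  refine ⟨p * q, hS p hpS q hqS, hp.mul hq, fun z hz => ⟨?_, fun i => ?_⟩⟩
  · have := abs_mul_sub_mul_le (hcp z hz).1 (hcq z hz).1
      ((hb₁ z hz).1.trans (le_max_left _ _)) ((hb₂ z hz).1.trans (le_max_right _ _)) hδ'1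
    simp only [Pi.mul_apply]
    linarith
  · rw [partialDeriv_mul (hf.differentiable one_ne_zero z) (hg.differentiable one_ne_zero z),
      partialDeriv_mul (hp.differentiable one_ne_zero z) (hq.differentiable one_ne_zero z)]
    have a := abs_le.1 (abs_mul_sub_mul_le (hcp z hz).1 ((hcq z hz).2 i)
      ((hb₁ z hz).1.trans (le_max_left _ _)) (((hb₂ z hz).2 i).trans (le_max_right _ _)) hδ'1)
    have b := abs_le.1 (abs_mul_sub_mul_le ((hcp z hz).2 i) (hcq z hz).1
      (((hb₁ z hz).2 i).trans (le_max_left _ _)) ((hb₂ z hz).1.trans (le_max_right _ _)) hδ'1)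
    rw [abs_le]; constructor <;> linarith [a.1, a.2, b.1, b.2]

theorem one_mem_c1Closure (h : (1 : (Fin n → ℝ) → ℝ) ∈ S) : 1 ∈ c1Closure K S :=
  mem_c1Closure contDiff_const h

/-- The `C¹` closure of a subalgebra. -/
def c1ClosureAlg (hK : IsCompact K) (A : Subalgebra ℝ ((Fin n → ℝ) → ℝ)) :
    Subalgebra ℝ ((Fin n → ℝ) → ℝ) :=
  (c1Closure K A.toSubmodule).toSubalgebra (one_mem_c1Closure A.one_mem)
    fun _ _ hf hg => mul_mem_c1Closure hK (fun _ hp _ hq => A.mul_mem hp hq) hf hg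

/-- Compositions with functions of one variable pass to the closure. -/
theorem comp_mem_c1Closure (hK : IsCompact K) {F : ℝ → ℝ} {g : (Fin n → ℝ) → ℝ}
    (hF : ContDiff ℝ 1 F) (hg : ContDiff ℝ 1 g)
    (h : ∀ R > 0, ∀ δ > 0, ∃ G : ℝ → ℝ, ContDiff ℝ 1 G ∧ G ∘ g ∈ S ∧
      ∀ s, |s| ≤ R → |F s - G s| ≤ δ ∧ |deriv F s - deriv G s| ≤ δ) :
    F ∘ g ∈ c1Closure K S := by
  refine ⟨hF.comp hg, fun δ hδ => ?_⟩
  obtain ⟨M, hM, hb⟩ := exists_C1_bound hK hg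
  -- The chain rule multiplies the error of the derivative by at most `M`, the bound on the partial
  -- derivatives of `g`.
  obtain ⟨G, hG, hGS, hc⟩ := h M hM (δ / (M + 1)) (by positivity)
  have hle : δ / (M + 1) ≤ δ := div_le_self hδ.le (by linarith)
  refine ⟨G ∘ g, hGS, hG.comp hg, fun z hz => ⟨((hc _ (hb z hz).1).1).trans hle, fun i => ?_⟩⟩
  rw [partialDeriv_comp (hF.differentiable one_ne_zero _) (hg.differentiable one_ne_zero z),
    partialDeriv_comp (hG.differentiable one_ne_zero _) (hg.differentiable one_ne_zero z),
    ← sub_mul, abs_mul]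
  calc |deriv F (g z) - deriv G (g z)| * |partialDeriv i g z|
      ≤ δ / (M + 1) * (M + 1) := by
        gcongr
        · exact (hc _ (hb z hz).1).2
        · linarith [(hb z hz).2 i]
    _ = δ := by field_simp

end Closure

/-- By the mean value inequality, closeness of derivatives gives closeness of values once the
functions agree at 0. The `C¹` estimates below therefore only need to treat derivatives. -/
theorem abs_sub_le_of_deriv_close {F G : ℝ → ℝ} {R δ : ℝ} (hF : Differentiable ℝ F)
    (hG : Differentiable ℝ G) (h0 : F 0 = G 0)
    (h : ∀ s, |s| ≤ R → |deriv F s - deriv G s| ≤ δ) :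
    ∀ s, |s| ≤ R → |F s - G s| ≤ δ * R := by
  intro s hs
  have hR : 0 ≤ R := (abs_nonneg s).trans hs
  have hδ : 0 ≤ δ := (abs_nonneg _).trans (h s hs)
  have key := (convex_Icc (-R) R).norm_image_sub_le_of_norm_deriv_le (f := fun s => F s - G s)
    (C := δ) (x := 0) (y := s) (fun x _ => (hF x).sub (hG x))
    (fun x hx => by
      rw [deriv_fun_sub (hF x) (hG x)]
      exact h x (abs_le.2 hx)) ⟨by linarith, hR⟩ (abs_le.1 hs)
  simp only [h0, sub_self, sub_zero, Real.norm_eq_abs] at key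
  exact key.trans (by gcongr)

/-! ### Hyperbolic tangent -/

theorem hasDerivAt_tanh (x : ℝ) : HasDerivAt Real.tanh (1 - Real.tanh x ^ 2) x := by
  have h := (Real.hasDerivAt_sinh x).div (Real.hasDerivAt_cosh x) (Real.cosh_pos x).ne'
  have e : Real.sinh / Real.cosh = Real.tanh := by
    ext y; simp [Real.tanh_eq_sinh_div_cosh]
  rw [e] at h
  refine h.congr_deriv ?_
  rw [Real.tanh_eq_sinh_div_cosh]
  have := (Real.cosh_pos x).ne'
  field_simp

theorem contDiff_tanh {k : WithTop ℕ∞} : ContDiff ℝ k Real.tanh := by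
  have e : Real.tanh = fun y => Real.sinh y / Real.cosh y := by
    ext y; simp [Real.tanh_eq_sinh_div_cosh]
  rw [e]
  exact Real.contDiff_sinh.div Real.contDiff_cosh fun x => (Real.cosh_pos x).ne'

/-- To leading order the right tail of `tanh` is an exponential; this is how exponentials are
extracted from networks. -/
theorem one_sub_tanh (x : ℝ) :
    1 - Real.tanh x = 2 * Real.exp (-2 * x) / (1 + Real.exp (-2 * x)) := by
  have h := (Real.cosh_pos x).ne'
  have e1 : Real.exp (-2 * x) = Real.exp (-x) * Real.exp (-x) := by
    rw [← Real.exp_add]; ring_nf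
  have e2 : Real.exp x * Real.exp (-x) = 1 := by rw [← Real.exp_add]; simp
  rw [Real.tanh_eq_sinh_div_cosh, e1]
  have h2 : Real.exp x + Real.exp (-x) ≠ 0 := by positivity
  rw [Real.sinh_eq, Real.cosh_eq]
  field_simp
  linear_combination (-2 * Real.exp (-x)) * e2

theorem abs_tanh_le (x : ℝ) : |Real.tanh x| ≤ |x| := by
  have := (convex_univ : Convex ℝ (univ : Set ℝ)).norm_image_sub_le_of_norm_deriv_le
    (f := Real.tanh) (C := 1) (x := 0) (y := x) (fun y _ => (hasDerivAt_tanh y).differentiableAt)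
    (fun y _ => by
      have := Real.tanh_lt_one y
      have := Real.neg_one_lt_tanh y
      rw [(hasDerivAt_tanh y).deriv, Real.norm_eq_abs, abs_le]
      constructor <;> nlinarith [sq_nonneg (Real.tanh y)]) trivial trivial
  simpa using this

/-! ### The functions realized by networks -/

namespace TanhNet

variable {d m m' : ℕ}

/-- The network computing the sum of the outputs of two networks. -/
def add (A : TanhNet d m) (B : TanhNet d m') : TanhNet d (m + m') where
  W₁ := Matrix.of (Fin.append (fun k => A.W₁ k) fun k => B.W₁ k)
  b₁ := Fin.append A.b₁ B.b₁
  W₂ := Matrix.of (Fin.append (fun k => Fin.append (A.W₂ k) 0) fun k => Fin.append 0 (B.W₂ k))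
  b₂ := Fin.append A.b₂ B.b₂
  W₃ := Fin.append A.W₃ B.W₃
  b₃ := A.b₃ + B.b₃

theorem eval_add (A : TanhNet d m) (B : TanhNet d m') (x : Fin d → ℝ) :
    (A.add B).eval x = A.eval x + B.eval x := by
  simp only [eval, add, dotProduct, Matrix.mulVec, Fin.sum_univ_add, Pi.add_apply,
    Matrix.of_apply, Fin.append_left, Fin.append_right, Pi.zero_apply, zero_mul,
    Finset.sum_const_zero, add_zero, zero_add]
  ring

/-- The network with all parameters zero. -/
def zero (d m : ℕ) : TanhNet d m := ⟨0, 0, 0, 0, 0, 0⟩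

@[simp] theorem eval_zero (x : Fin d → ℝ) : (zero d m).eval x = 0 := by
  simp [zero, eval]

/-- Padding with a zero network raises the width without changing the function. -/
theorem exists_eval_eq_of_le (h : m ≤ m') (A : TanhNet d m) :
    ∃ B : TanhNet d m', B.eval = A.eval := by
  obtain ⟨k, rfl⟩ := Nat.exists_eq_add_of_le h
  exact ⟨A.add (zero d k), funext fun x => by simp [eval_add]⟩

/-- Scaling of the output. -/
def smul (c : ℝ) (A : TanhNet d m) : TanhNet d m := { A with W₃ := c • A.W₃, b₃ := c * A.b₃ }

theorem eval_smul (c : ℝ) (A : TanhNet d m) (x : Fin d → ℝ) :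
    (A.smul c).eval x = c * A.eval x := by
  simp only [eval, smul, smul_dotProduct, smul_eq_mul]
  ring

end TanhNet

/-- The functions `A ∘ Φ` with `A` realized by a network. -/
def netSpan {n d : ℕ} (Φ : (Fin n → ℝ) → Fin d → ℝ) : Submodule ℝ ((Fin n → ℝ) → ℝ) where
  carrier := {f | ∃ (m : ℕ) (A : TanhNet d m), f = fun z => A.eval (Φ z)}
  zero_mem' := ⟨0, TanhNet.zero d 0, by ext; simp⟩
  add_mem' := by
    rintro _ _ ⟨m, A, rfl⟩ ⟨m', B, rfl⟩
    exact ⟨m + m', A.add B, by ext z; simp [TanhNet.eval_add]⟩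
  smul_mem' := by
    rintro c _ ⟨m, A, rfl⟩
    exact ⟨m, A.smul c, by ext z; simp [TanhNet.eval_smul]⟩

section Nets

variable {n d : ℕ} {Φ : (Fin n → ℝ) → Fin d → ℝ} {K : Set (Fin n → ℝ)}

theorem contDiff_ridge (hΦ : ContDiff ℝ 1 Φ) (w : Fin d → ℝ) : ContDiff ℝ 1 fun z => w ⬝ᵥ Φ z := by
  have h := contDiff_pi.1 hΦ
  unfold dotProduct
  exact ContDiff.sum fun i _ => contDiff_const.mul (h i)

theorem const_mem_netSpan (c : ℝ) : (fun _ => c) ∈ netSpan Φ :=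
  ⟨0, ⟨0, 0, 0, 0, 0, c⟩, by ext; simp [TanhNet.eval]⟩

theorem tanh_scaled_mem_netSpan (w : Fin d → ℝ) (b a : ℝ) :
    (fun z => a⁻¹ * Real.tanh (a * Real.tanh (w ⬝ᵥ Φ z + b))) ∈ netSpan Φ :=
  ⟨1, ⟨Matrix.of fun _ => w, fun _ => b, Matrix.of fun _ _ => a, 0, fun _ => a⁻¹, 0⟩, by
    ext z; simp [TanhNet.eval, dotProduct, Matrix.mulVec]⟩

/-- Networks with one hidden layer are limits of networks with two hidden layers. -/
theorem tanh_ridge_mem_closure (hK : IsCompact K) (hΦ : ContDiff ℝ 1 Φ) (w : Fin d → ℝ) (b : ℝ) :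
    (fun z => Real.tanh (w ⬝ᵥ Φ z + b)) ∈ c1Closure K (netSpan Φ) := by
  refine comp_mem_c1Closure (F := id) (g := fun z => Real.tanh (w ⬝ᵥ Φ z + b)) hK contDiff_id
    (contDiff_tanh.comp ((contDiff_ridge hΦ w).add contDiff_const)) fun R hR δ hδ => ?_
  -- The second layer computes `tanh (a s) / a`, which tends to `s` in `C¹` as `a → 0`. Its
  -- derivative is off by `tanh² (a s) ≤ (a R)² ≤ a R`, and its value by at most `a R · R`.
  obtain ⟨a, ha0, ha1, ha2⟩ : ∃ a : ℝ, 0 < a ∧ a * R ≤ 1 ∧ a * R * (R + 1) ≤ δ := by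
    refine ⟨min (1 / R) (δ / (R * (R + 1))), lt_min (by positivity) (by positivity), ?_, ?_⟩
    · calc _ ≤ 1 / R * R := by gcongr; exact min_le_left _ _
        _ = 1 := by field_simp
    · rw [mul_assoc]
      calc _ ≤ δ / (R * (R + 1)) * (R * (R + 1)) := by gcongr; exact min_le_right _ _
        _ = δ := by field_simp
  have hd : ∀ s, HasDerivAt (fun s => a⁻¹ * Real.tanh (a * s)) (1 - Real.tanh (a * s) ^ 2) s := by
    intro s
    have := ((hasDerivAt_tanh (a * s)).comp s ((hasDerivAt_id s).const_mul a)).const_mul a⁻¹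
    refine this.congr_deriv ?_
    field_simp
  have hder : ∀ s, |s| ≤ R →
      |deriv id s - deriv (fun s => a⁻¹ * Real.tanh (a * s)) s| ≤ a * R := by
    intro s hs
    rw [(hd s).deriv, deriv_id, sub_sub_cancel, abs_pow]
    have h1 : |Real.tanh (a * s)| ≤ a * R := (abs_tanh_le _).trans (by
      rw [abs_mul, abs_of_pos ha0]; gcongr)
    calc |Real.tanh (a * s)| ^ 2 ≤ (a * R) ^ 2 := by gcongr
      _ ≤ a * R := by nlinarith [mul_pos ha0 hR]
  refine ⟨fun s => a⁻¹ * Real.tanh (a * s),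
    contDiff_const.mul (contDiff_tanh.comp (contDiff_const.mul contDiff_id)),
    tanh_scaled_mem_netSpan w b a, fun s hs => ⟨?_, (hder s hs).trans ?_⟩⟩
  · refine (abs_sub_le_of_deriv_close differentiable_id
      (fun s => (hd s).differentiableAt) (by simp) hder s hs).trans ?_
    nlinarith [mul_pos ha0 hR]
  · nlinarith [mul_pos ha0 hR, mul_pos (mul_pos ha0 hR) hR]

/-- The exponential is a limit of shifted and scaled hyperbolic tangents. -/
theorem exp_ridge_mem_closure (hK : IsCompact K) (hΦ : ContDiff ℝ 1 Φ) (w : Fin d → ℝ) :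
    (fun z => Real.exp (w ⬝ᵥ Φ z)) ∈ c1Closure K (netSpan Φ) := by
  -- The approximants are built from one-layer `tanh` ridges, which are themselves only in the
  -- closure.
  apply c1Closure_c1Closure_le
  have hw : (fun z => Real.exp (w ⬝ᵥ Φ z)) =
      (fun s => Real.exp (-2 * s)) ∘ fun z => ((-1 / 2 : ℝ) • w) ⬝ᵥ Φ z := by
    ext z; simp only [Function.comp, smul_dotProduct, smul_eq_mul]; congr 1; ring
  rw [hw]
  refine comp_mem_c1Closure hK (by fun_prop) (contDiff_ridge hΦ _) fun R hR δ hδ => ?_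
  -- With `E = exp (-2s)` and `q = exp (-2b)`, the approximant is `E / (1 + E q)`. Both errors turn
  -- out to be at most `4 E² q`, and `E² ≤ exp (4R)` when `|s| ≤ R`.
  obtain ⟨b, hb⟩ : ∃ b : ℝ, 4 * Real.exp (4 * R) * Real.exp (-2 * b) ≤ δ := by
    refine ⟨-Real.log (δ / (4 * Real.exp (4 * R))) / 2, ?_⟩
    rw [show -2 * (-Real.log (δ / (4 * Real.exp (4 * R))) / 2)
      = Real.log (δ / (4 * Real.exp (4 * R))) by ring, Real.exp_log (by positivity)]
    apply le_of_eq; field_simp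
  have hd : ∀ s, HasDerivAt (fun s => Real.exp (2 * b) / 2 * (1 - Real.tanh (s + b)))
      (-(Real.exp (2 * b) / 2 * (1 - Real.tanh (s + b) ^ 2))) s := fun s => by
    have := (((hasDerivAt_tanh (s + b)).comp s ((hasDerivAt_id s).add_const b)).const_sub
      1).const_mul (Real.exp (2 * b) / 2)
    refine this.congr_deriv ?_
    ring
  have hd' : ∀ s, HasDerivAt (fun s => Real.exp (-2 * s)) (-2 * Real.exp (-2 * s)) s := fun s => by
    have := (((hasDerivAt_id s).const_mul (-2)).exp)
    refine this.congr_deriv ?_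
    simp; ring
  refine ⟨fun s => Real.exp (2 * b) / 2 * (1 - Real.tanh (s + b)),
    contDiff_const.mul (contDiff_const.sub (contDiff_tanh.comp (contDiff_id.add contDiff_const))),
    ?_, fun s hs => ?_⟩
  · have h1 := (c1Closure K (netSpan Φ)).sub_mem
      (mem_c1Closure contDiff_const (const_mem_netSpan (Φ := Φ) (Real.exp (2 * b) / 2)))
      ((c1Closure K (netSpan Φ)).smul_mem (Real.exp (2 * b) / 2)
        (tanh_ridge_mem_closure hK hΦ ((-1 / 2 : ℝ) • w) b))
    convert h1 using 1
    ext z; simp; ring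
  · rw [(hd s).deriv, (hd' s).deriv]
    set E := Real.exp (-2 * s) with hE
    set q := Real.exp (-2 * b) with hq
    have hE0 : 0 < E := Real.exp_pos _
    have hq0 : 0 < q := Real.exp_pos _
    have hEq : Real.exp (-2 * (s + b)) = E * q := by
      rw [hE, hq, ← Real.exp_add]; ring_nf
    have hbq : Real.exp (2 * b) = 1 / q := by
      rw [hq, one_div, ← Real.exp_neg]; ring_nf
    have hE2 : E ^ 2 ≤ Real.exp (4 * R) := by
      rw [hE, ← Real.exp_nat_mul]
      apply Real.exp_le_exp.2
      have := (abs_le.1 hs).1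
      push_cast; linarith
    have hfin : 4 * (E ^ 2 * q) ≤ δ := le_trans (by nlinarith) hb
    have ht : Real.tanh (s + b) = 1 - 2 * (E * q) / (1 + E * q) := by
      rw [← hEq]; linarith [one_sub_tanh (s + b)]
    have hpos : 0 < 1 + E * q := by positivity
    have e1 : E - Real.exp (2 * b) / 2 * (1 - Real.tanh (s + b)) = E ^ 2 * q / (1 + E * q) := by
      rw [hbq, ht]; field_simp; ring
    have e2 : -2 * E - -(Real.exp (2 * b) / 2 * (1 - Real.tanh (s + b) ^ 2)) =
        -(2 * (E ^ 2 * q) * ((2 + E * q) / (1 + E * q) ^ 2)) := by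
      rw [hbq, ht]; field_simp; ring
    have hP : 0 < E ^ 2 * q := by positivity
    have hEq0 : 0 < E * q := by positivity
    refine ⟨?_, ?_⟩
    · rw [e1, abs_of_pos (by positivity)]
      exact (div_le_self hP.le (by linarith)).trans (by linarith)
    · rw [e2, abs_neg, abs_of_pos (by positivity)]
      have : (2 + E * q) / (1 + E * q) ^ 2 ≤ 2 := by
        rw [div_le_iff₀ (by positivity)]; nlinarith
      nlinarith

/-- The algebra generated by exponentials of linear forms in `Φ`. -/
def expAlg (Φ : (Fin n → ℝ) → Fin d → ℝ) : Subalgebra ℝ ((Fin n → ℝ) → ℝ) :=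
  Algebra.adjoin ℝ (range fun w : Fin d → ℝ => fun z => Real.exp (w ⬝ᵥ Φ z))

theorem exp_mem_expAlg (w : Fin d → ℝ) : (fun z => Real.exp (w ⬝ᵥ Φ z)) ∈ expAlg Φ :=
  Algebra.subset_adjoin ⟨w, rfl⟩

/-- Products of exponentials of linear forms are again such exponentials, so the algebra they
generate is just their linear span. This supplies the multiplicative structure that networks lack.
-/
theorem expAlg_le_closure (hK : IsCompact K) (hΦ : ContDiff ℝ 1 Φ) :
    (expAlg Φ).toSubmodule ≤ c1Closure K (netSpan Φ) := by
  rw [expAlg, Algebra.adjoin_eq_span, Submodule.span_le]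
  intro f hf
  obtain ⟨w, rfl⟩ : ∃ w : Fin d → ℝ, (fun z => Real.exp (w ⬝ᵥ Φ z)) = f := by
    induction hf using Submonoid.closure_induction with
    | mem f hf => exact hf
    | one => exact ⟨0, by ext; simp⟩
    | mul f g _ _ hf hg =>
      obtain ⟨v, rfl⟩ := hf
      obtain ⟨w, rfl⟩ := hg
      exact ⟨v + w, by ext; simp [add_dotProduct, Real.exp_add]⟩
  exact exp_ridge_mem_closure hK hΦ w

/-- The difference quotients `(exp (a s) - 1) / a` tend to `s` in `C¹` as `a → 0`. -/
theorem coord_mem_closure_expAlg (hK : IsCompact K) (hΦ : ContDiff ℝ 1 Φ) (i : Fin d) :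
    (fun z => Φ z i) ∈ c1Closure K (expAlg Φ).toSubmodule := by
  refine comp_mem_c1Closure (F := id) (g := fun z => Φ z i) hK contDiff_id
    (contDiff_pi.1 hΦ i) fun R hR δ hδ => ?_
  obtain ⟨a, ha0, ha1⟩ : ∃ a : ℝ, 0 < a ∧ ∀ s, |s| ≤ a * R → |1 - Real.exp s| ≤ δ / (R + 1) := by
    have h : ∀ᶠ s in 𝓝 (0 : ℝ), |1 - Real.exp s| < δ / (R + 1) := by
      have hc : Continuous fun s => |1 - Real.exp s| := by fun_prop
      have := hc.tendsto 0
      simp only [Real.exp_zero, sub_self, abs_zero] at this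
      exact this.eventually (gt_mem_nhds (by positivity))
    obtain ⟨r, hr, hb⟩ := Metric.eventually_nhds_iff.1 h
    refine ⟨r / (2 * R), by positivity, fun s hs => (hb ?_).le⟩
    have : r / (2 * R) * R = r / 2 := by field_simp
    rw [Real.dist_eq, sub_zero]; linarith
  have hd : ∀ s, HasDerivAt (fun s => a⁻¹ * (Real.exp (a * s) - 1)) (Real.exp (a * s)) s := by
    intro s
    have := ((((hasDerivAt_id s).const_mul a).exp).sub_const 1).const_mul a⁻¹
    refine this.congr_deriv ?_
    simp; field_simp
  have hder : ∀ s, |s| ≤ R →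
      |deriv id s - deriv (fun s => a⁻¹ * (Real.exp (a * s) - 1)) s| ≤ δ / (R + 1) := by
    intro s hs
    rw [(hd s).deriv, deriv_id]
    refine ha1 _ ?_
    rw [abs_mul, abs_of_pos ha0]; gcongr
  have hle : δ / (R + 1) ≤ δ := div_le_self hδ.le (by linarith)
  refine ⟨fun s => a⁻¹ * (Real.exp (a * s) - 1), by fun_prop, ?_,
    fun s hs => ⟨?_, (hder s hs).trans hle⟩⟩
  · have := (expAlg Φ).smul_mem ((expAlg Φ).sub_mem (exp_mem_expAlg (Φ := Φ) (Pi.single i a))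
      (expAlg Φ).one_mem) a⁻¹
    have e : (fun s => a⁻¹ * (Real.exp (a * s) - 1)) ∘ (fun z => Φ z i) =
        a⁻¹ • ((fun z => Real.exp (Pi.single i a ⬝ᵥ Φ z)) - 1) := by ext z; simp
    rw [e]; exact this
  · refine (abs_sub_le_of_deriv_close differentiable_id
      (fun s => (hd s).differentiableAt) (by simp) hder s hs).trans ?_
    rw [div_mul_eq_mul_div, div_le_iff₀ (by positivity)]
    nlinarith

theorem exists_derivative_eq (q : Polynomial ℝ) : ∃ p : Polynomial ℝ, p.derivative = q := by
  induction q using Polynomial.induction_on' with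
  | add p q hp hq =>
    obtain ⟨p', rfl⟩ := hp
    obtain ⟨q', rfl⟩ := hq
    exact ⟨p' + q', by simp⟩
  | monomial k a =>
    refine ⟨Polynomial.monomial (k + 1) (a / (k + 1)), ?_⟩
    rw [Polynomial.derivative_monomial]
    have : ((k : ℝ) + 1) ≠ 0 := by positivity
    simp [this]

/-- The Weierstrass theorem in the `C¹` norm. -/
theorem exists_polynomial_C1_close {F : ℝ → ℝ} (hF : ContDiff ℝ 1 F) {R δ : ℝ} (hR : 0 < R)
    (hδ : 0 < δ) : ∃ p : Polynomial ℝ, ∀ s, |s| ≤ R →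
      |F s - p.eval s| ≤ δ ∧ |deriv F s - deriv (fun s => p.eval s) s| ≤ δ := by
  -- Weierstrass is applied to the derivative; an antiderivative of the polynomial is then shifted
  -- to agree with `F` at 0.
  obtain ⟨q, hq⟩ := exists_polynomial_near_of_continuousOn (-R) R (deriv F)
    (hF.continuous_deriv le_rfl).continuousOn (δ / (R + 1)) (by positivity)
  obtain ⟨p, rfl⟩ := exists_derivative_eq q
  set P := p + Polynomial.C (F 0 - p.eval 0) with hP
  have hder : ∀ s, |s| ≤ R → |deriv F s - deriv (fun s => P.eval s) s| ≤ δ / (R + 1) := by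
    intro s hs
    rw [Polynomial.deriv, abs_sub_comm]
    simpa [hP] using (hq s (abs_le.1 hs)).le
  have hle : δ / (R + 1) ≤ δ := div_le_self hδ.le (by linarith)
  refine ⟨P, fun s hs => ⟨?_, (hder s hs).trans hle⟩⟩
  refine (abs_sub_le_of_deriv_close (hF.differentiable one_ne_zero) P.differentiable
    (by simp [hP]) hder s hs).trans ?_
  rw [div_mul_eq_mul_div, div_le_iff₀ (by positivity)]
  nlinarith

/-- Functions of one feature are limits of networks, and so are all their products and sums. -/
theorem adjoin_le_closure_netSpan (hK : IsCompact K) (hΦ : ContDiff ℝ 1 Φ) :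
    (Algebra.adjoin ℝ {f : (Fin n → ℝ) → ℝ |
        ∃ (F : ℝ → ℝ) (i : Fin d), ContDiff ℝ 1 F ∧ f = fun z => F (Φ z i)}).toSubmodule ≤
      c1Closure K (netSpan Φ) := by
  -- It is enough to land in the closure of `expAlg Φ`, which, being an algebra, can be tested on
  -- generators.
  refine le_trans ?_ (c1Closure_le_of_le (expAlg_le_closure hK hΦ))
  have h : Algebra.adjoin ℝ {f : (Fin n → ℝ) → ℝ |
        ∃ (F : ℝ → ℝ) (i : Fin d), ContDiff ℝ 1 F ∧ f = fun z => F (Φ z i)} ≤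
      c1ClosureAlg hK (expAlg Φ) := by
    apply Algebra.adjoin_le
    rintro _ ⟨F, i, hF, rfl⟩
    refine c1Closure_c1Closure_le (comp_mem_c1Closure (F := F) (g := fun z => Φ z i) hK hF
      (contDiff_pi.1 hΦ i) fun R hR δ hδ => ?_)
    obtain ⟨p, hp⟩ := exists_polynomial_C1_close hF hR hδ
    refine ⟨fun s => p.eval s, by simpa using p.contDiff_aeval (𝕜 := ℝ) 1, ?_, hp⟩
    have hx : (fun z => Φ z i) ∈ c1ClosureAlg hK (expAlg Φ) := coord_mem_closure_expAlg hK hΦ i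
    have e : (fun s => p.eval s) ∘ (fun z => Φ z i) = Polynomial.aeval (fun z => Φ z i) p := by
      rw [Polynomial.aeval_pi_apply]
      ext z
      simp [Polynomial.aeval_def, Polynomial.eval₂_eq_eval_map]
    rw [e]
    exact Algebra.adjoin_le (singleton_subset_iff.2 hx)
      (Polynomial.aeval_mem_adjoin_singleton ℝ (fun z => Φ z i))
  exact h

end Nets

/-! ### Boxes -/

section Box

variable {n : ℕ} {lo hi : Fin n → ℝ}

theorem mem_openBox {z : Fin n → ℝ} : z ∈ openBox lo hi ↔ ∀ i, z i ∈ Ioo (lo i) (hi i) := by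
  simp [openBox]

theorem isOpen_openBox : IsOpen (openBox lo hi) := isOpen_set_pi finite_univ fun _ _ => isOpen_Ioo

theorem measurableSet_openBox : MeasurableSet (openBox lo hi) := isOpen_openBox.measurableSet

theorem openBox_subset_Icc : openBox lo hi ⊆ Icc lo hi := fun _ hz =>
  ⟨fun i => (mem_openBox.1 hz i).1.le, fun i => (mem_openBox.1 hz i).2.le⟩

instance : IsFiniteMeasure (volume.restrict (openBox lo hi)) :=
  isFiniteMeasure_restrict.2
    ((measure_mono openBox_subset_Icc).trans_lt isCompact_Icc.measure_lt_top).ne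

theorem memLp_of_continuous {f : (Fin n → ℝ) → ℝ} (hf : Continuous f) (p : ENNReal) :
    MemLp f p (volume.restrict (openBox lo hi)) := by
  obtain ⟨C, hC⟩ := (isCompact_Icc (a := lo) (b := hi)).exists_bound_of_continuousOn hf.continuousOn
  exact MemLp.of_bound hf.aestronglyMeasurable C
    ((ae_restrict_iff' measurableSet_openBox).2 (.of_forall fun z hz => hC z (openBox_subset_Icc hz)))

end Box

/-! ### Products of functions of one variable -/

/-- The function `z ↦ ∏ⱼ fⱼ(zⱼ)`. -/
def tensor {n : ℕ} (f : Fin n → ℝ → ℝ) (z : Fin n → ℝ) : ℝ := ∏ j, f j (z j)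

theorem hasDerivAt_comp_update {n : ℕ} {u : (Fin n → ℝ) → ℝ} {z : Fin n → ℝ} {i : Fin n} {s : ℝ}
    (hu : DifferentiableAt ℝ u (Function.update z i s)) :
    HasDerivAt (fun s => u (Function.update z i s)) (partialDeriv i u (Function.update z i s)) s :=
  hu.hasFDerivAt.comp_hasDerivAt s (hasDerivAt_update z i s)

section Tensor

variable {n : ℕ} {f : Fin n → ℝ → ℝ}

theorem contDiff_tensor {k : WithTop ℕ∞} (hf : ∀ j, ContDiff ℝ k (f j)) :
    ContDiff ℝ k (tensor f) := by
  unfold tensor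
  exact contDiff_prod fun j _ => (hf j).comp (contDiff_apply ℝ ℝ j)

theorem tensor_update (f : Fin n → ℝ → ℝ) (i : Fin n) (g : ℝ → ℝ) (z : Fin n → ℝ) :
    tensor (Function.update f i g) z = g (z i) * ∏ j ∈ Finset.univ.erase i, f j (z j) := by
  unfold tensor
  rw [← Finset.mul_prod_erase _ _ (Finset.mem_univ i), Function.update_self]
  congr 1
  exact Finset.prod_congr rfl fun j hj => by rw [Function.update_of_ne (Finset.ne_of_mem_erase hj)]

theorem partialDeriv_tensor (hf : ∀ j, ContDiff ℝ 1 (f j)) (i : Fin n) :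
    partialDeriv i (tensor f) = tensor (Function.update f i (deriv (f i))) := by
  ext z
  have h1 := hasDerivAt_comp_update (i := i) (s := z i)
    (z := z) ((contDiff_tensor hf).differentiable one_ne_zero _)
  rw [Function.update_eq_self] at h1
  have h2 : (fun s => tensor f (Function.update z i s)) =
      fun s => f i s * ∏ j ∈ Finset.univ.erase i, f j (z j) := by
    ext s
    unfold tensor
    rw [← Finset.mul_prod_erase _ _ (Finset.mem_univ i), Function.update_self]
    congr 1
    exact Finset.prod_congr rfl fun j hj => by
      rw [Function.update_of_ne (Finset.ne_of_mem_erase hj)]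
  rw [h2] at h1
  rw [tensor_update]
  exact h1.unique ((((hf i).differentiable one_ne_zero) (z i)).hasDerivAt.mul_const _)

end Tensor

/-! ### Cutoff functions -/

/-- A smooth function which is `0` on `(-∞, 1]` and `1` on `[2, ∞)`. -/
noncomputable def smoothStep (y : ℝ) : ℝ := Real.smoothTransition (y - 1)

theorem contDiff_smoothStep : ContDiff ℝ ∞ smoothStep :=
  Real.smoothTransition.contDiff.comp (contDiff_id.sub contDiff_const)

theorem abs_smoothStep_le (y : ℝ) : |smoothStep y| ≤ 1 := by
  rw [smoothStep, abs_of_nonneg (Real.smoothTransition.nonneg _)]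
  exact Real.smoothTransition.le_one _

theorem smoothStep_of_le {y : ℝ} (h : y ≤ 1) : smoothStep y = 0 :=
  Real.smoothTransition.zero_of_nonpos (by linarith)

theorem smoothStep_of_ge {y : ℝ} (h : 2 ≤ y) : smoothStep y = 1 :=
  Real.smoothTransition.one_of_one_le (by linarith)

/-- The derivative lives on `[1, 2]`. The quantity `y χ'(y)` is invariant under scaling: at `y = m
s` it bounds the derivative of the steep cutoff `χ (m s)`, multiplied by `s`, uniformly in `m`. -/
theorem exists_mul_deriv_smoothStep_le : ∃ C, ∀ y, |y * deriv smoothStep y| ≤ C := by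
  have hc : Continuous fun y => y * deriv smoothStep y :=
    continuous_id.mul (contDiff_smoothStep.continuous_deriv (by simp))
  have hs : HasCompactSupport fun y => y * deriv smoothStep y := by
    refine HasCompactSupport.intro (isCompact_Icc (a := (0 : ℝ)) (b := 3)) fun y hy => ?_
    rw [mem_Icc, not_and_or, not_le, not_le] at hy
    have : deriv smoothStep y = 0 := by
      rcases hy with hy | hy
      · have : smoothStep =ᶠ[𝓝 y] fun _ => 0 := by
          filter_upwards [gt_mem_nhds hy] with x hx using smoothStep_of_le (by linarith)
        rw [this.deriv_eq]; simp
      · have : smoothStep =ᶠ[𝓝 y] fun _ => 1 := by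
          filter_upwards [lt_mem_nhds hy] with x hx using smoothStep_of_ge (by linarith)
        rw [this.deriv_eq]; simp
    simp [this]
  exact hc.bounded_above_of_compact_support hs

/-- A smooth cutoff function on the interval `(a, b)`. -/
noncomputable def cutoff (a b m s : ℝ) : ℝ := smoothStep (m * (s - a)) * smoothStep (m * (b - s))

section Cutoff

variable {a b m s : ℝ}

theorem contDiff_cutoff : ContDiff ℝ ∞ (cutoff a b m) :=
  (contDiff_smoothStep.comp (by fun_prop)).mul (contDiff_smoothStep.comp (by fun_prop))

theorem abs_cutoff_le : |cutoff a b m s| ≤ 1 := by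
  rw [cutoff, abs_mul]
  exact mul_le_one₀ (abs_smoothStep_le _) (abs_nonneg _) (abs_smoothStep_le _)

theorem mem_Icc_of_cutoff_ne_zero (hm : 0 < m) (h : cutoff a b m s ≠ 0) :
    s ∈ Icc (a + 1 / m) (b - 1 / m) := by
  rw [cutoff] at h
  have h1 : 1 < m * (s - a) := by
    by_contra! hc
    exact h (by rw [smoothStep_of_le hc, zero_mul])
  have h2 : 1 < m * (b - s) := by
    by_contra! hc
    exact h (by rw [smoothStep_of_le hc, mul_zero])
  have h1' : 1 / m < s - a := by rw [div_lt_iff₀ hm]; linarith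
  have h2' : 1 / m < b - s := by rw [div_lt_iff₀ hm]; linarith
  constructor <;> linarith

/-- Equality of germs, and not only of values, lets derivatives pass to the limit as well. -/
theorem eventually_cutoff_eq_one (hs : s ∈ Ioo a b) :
    ∀ᶠ k : ℕ in atTop, cutoff a b (k + 1) =ᶠ[𝓝 s] fun _ => 1 := by
  have key : ∀ c > 0, ∀ᶠ k : ℕ in atTop, 2 ≤ ((k : ℝ) + 1) * c := by
    intro c hc
    filter_upwards [(tendsto_natCast_atTop_atTop (R := ℝ)).eventually_ge_atTop (2 / c)] with k hk
    rw [div_le_iff₀ hc] at hk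
    linarith
  have ha : 0 < (s - a) / 2 := by linarith [hs.1]
  have hb : 0 < (b - s) / 2 := by linarith [hs.2]
  filter_upwards [key _ ha, key _ hb] with k hka hkb
  filter_upwards [lt_mem_nhds (show s - (s - a) / 2 < s by linarith),
    gt_mem_nhds (show s < s + (b - s) / 2 by linarith)] with x h1 h2
  have hk : (0 : ℝ) < k + 1 := by positivity
  rw [cutoff, smoothStep_of_ge, smoothStep_of_ge, one_mul]
  · exact hkb.trans (by gcongr; linarith)
  · exact hka.trans (by gcongr; linarith)

theorem hasDerivAt_cutoff : HasDerivAt (cutoff a b m)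
    (m * deriv smoothStep (m * (s - a)) * smoothStep (m * (b - s)) -
      smoothStep (m * (s - a)) * (m * deriv smoothStep (m * (b - s)))) s := by
  have hd : ∀ y, HasDerivAt smoothStep (deriv smoothStep y) y := fun y =>
    (contDiff_smoothStep.differentiable (by simp) y).hasDerivAt
  have h1 := (hd (m * (s - a))).comp s (((hasDerivAt_id s).sub_const a).const_mul m)
  have h2 := (hd (m * (b - s))).comp s (((hasDerivAt_id s).const_sub b).const_mul m)
  exact (h1.mul h2).congr_deriv (by simp [Function.comp]; ring)

/-- If `f` vanishes at both ends of the interval, then the derivatives of its products with the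
cutoff functions remain bounded. -/
theorem exists_deriv_cutoff_mul_le (hab : a < b) {f : ℝ → ℝ} (hf : ContDiff ℝ 1 f) (ha : f a = 0)
    (hb : f b = 0) :
    ∃ C, ∀ k : ℕ, ∀ s ∈ Ioo a b, |deriv (fun s => cutoff a b (k + 1) s * f s) s| ≤ C := by
  obtain ⟨C, hC⟩ := exists_mul_deriv_smoothStep_le
  obtain ⟨L, hL⟩ := (isCompact_Icc (a := a) (b := b)).exists_bound_of_continuousOn
    (hf.continuous_deriv le_rfl).continuousOn
  have hd : ∀ x, DifferentiableAt ℝ f x := hf.differentiable one_ne_zero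
  have hL0 : 0 ≤ L := (norm_nonneg _).trans (hL a ⟨le_rfl, hab.le⟩)
  refine ⟨L * C + L * C + L, fun k s hs => ?_⟩
  have hsI : s ∈ Icc a b := Ioo_subset_Icc_self hs
  have hfa : |f s| ≤ L * (s - a) := by
    have := (convex_Icc a b).norm_image_sub_le_of_norm_deriv_le (fun x _ => hd x) hL
      (left_mem_Icc.2 hab.le) hsI
    simpa [ha, abs_of_pos (sub_pos.2 hs.1)] using this
  have hfb : |f s| ≤ L * (b - s) := by
    have := (convex_Icc a b).norm_image_sub_le_of_norm_deriv_le (fun x _ => hd x) hL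
      (right_mem_Icc.2 hab.le) hsI
    rw [hb, sub_zero, Real.norm_eq_abs, Real.norm_eq_abs, abs_sub_comm,
      abs_of_pos (sub_pos.2 hs.2)] at this
    exact this
  have hk : (0 : ℝ) < k + 1 := by positivity
  -- Here `c` is the distance to an endpoint. The linear vanishing of `f` there cancels the factor
  -- `k + 1` from differentiating the cutoff.
  have bound : ∀ c, 0 < c → |f s| ≤ L * c →
      |((k : ℝ) + 1) * deriv smoothStep ((k + 1) * c)| * |f s| ≤ L * C := by
    intro c hc hfc
    calc |((k : ℝ) + 1) * deriv smoothStep ((k + 1) * c)| * |f s|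
        ≤ |((k : ℝ) + 1) * deriv smoothStep ((k + 1) * c)| * (L * c) := by gcongr
      _ = L * |(k + 1) * c * deriv smoothStep ((k + 1) * c)| := by
        rw [abs_mul, abs_mul, abs_mul, abs_of_pos hc]; ring
      _ ≤ L * C := by gcongr; exact hC _
  have h := (hasDerivAt_cutoff (a := a) (b := b) (m := k + 1) (s := s)).mul (hd s).hasDerivAt
  have hfn : (fun s => cutoff a b (k + 1) s * f s) = cutoff a b (k + 1) * f := rfl
  rw [hfn, h.deriv, sub_mul]
  refine (abs_add_le _ _).trans (add_le_add ((abs_sub _ _).trans (add_le_add ?_ ?_)) ?_)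
  · rw [mul_right_comm, abs_mul, abs_mul _ (f s)]
    calc _ ≤ L * C * 1 := mul_le_mul (bound _ (sub_pos.2 hs.1) hfa) (abs_smoothStep_le _)
          (abs_nonneg _) ((by positivity : (0:ℝ) ≤ _).trans (bound _ (sub_pos.2 hs.1) hfa))
      _ = L * C := mul_one _
  · rw [mul_assoc, abs_mul, abs_mul _ (f s)]
    calc _ ≤ 1 * (L * C) := mul_le_mul (abs_smoothStep_le _) (bound _ (sub_pos.2 hs.2) hfb)
          (by positivity) zero_le_one
      _ = L * C := one_mul _
  · rw [abs_mul]
    calc _ ≤ 1 * L := mul_le_mul abs_cutoff_le (hL s hsI) (abs_nonneg _) zero_le_one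
      _ = L := one_mul _

end Cutoff

/-! ### Integration by parts with product test functions -/

/-- The defining identity of weak derivatives extends to smooth products which vanish on the faces
orthogonal to the direction of differentiation. -/
theorem HasWeakPartial.integral_tensor {n : ℕ} {lo hi : Fin n → ℝ} (hlt : ∀ j, lo j < hi j)
    {i : Fin n} {u v : (Fin n → ℝ) → ℝ}
    (hu : Integrable u (volume.restrict (openBox lo hi)))
    (hv : Integrable v (volume.restrict (openBox lo hi)))
    (huv : ∀ ψ : (Fin n → ℝ) → ℝ, ContDiff ℝ ∞ ψ → HasCompactSupport ψ →
      tsupport ψ ⊆ openBox lo hi →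
      ∫ z in openBox lo hi, u z * partialDeriv i ψ z = -∫ z in openBox lo hi, v z * ψ z)
    {f : Fin n → ℝ → ℝ}
    (hf : ∀ j, ContDiff ℝ ∞ (f j)) (hflo : f i (lo i) = 0) (hfhi : f i (hi i) = 0) :
    ∫ z in openBox lo hi, u z * partialDeriv i (tensor f) z =
      -∫ z in openBox lo hi, v z * tensor f z := by
  have hf1 : ∀ j, ContDiff ℝ 1 (f j) := fun j => (hf j).of_le (by simp)
  -- Every factor is cut off to obtain compact support. Only the `i`-th factor is differentiated, so
  -- only that one has to vanish at its endpoints for the dominated convergence below.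
  set F : ℕ → Fin n → ℝ → ℝ := fun k j s => cutoff (lo j) (hi j) (k + 1) s * f j s with hF
  have hFs : ∀ k j, ContDiff ℝ ∞ (F k j) := fun k j => contDiff_cutoff.mul (hf j)
  have hFs1 : ∀ k j, ContDiff ℝ 1 (F k j) := fun k j => (hFs k j).of_le (by simp)
  choose C hC using fun j => (isCompact_Icc (a := lo j) (b := hi j)).exists_bound_of_continuousOn
    (hf j).continuous.continuousOn
  have hFC : ∀ k j, ∀ s ∈ Ioo (lo j) (hi j), |F k j s| ≤ C j := fun k j s hs => by
    rw [hF, abs_mul]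
    calc _ ≤ 1 * C j := mul_le_mul abs_cutoff_le (hC j s (Ioo_subset_Icc_self hs))
          (abs_nonneg _) zero_le_one
      _ = C j := one_mul _
  obtain ⟨C', hC'⟩ := exists_deriv_cutoff_mul_le (hlt i) (hf1 i) hflo hfhi
  have hsupp : ∀ k, tsupport (tensor (F k)) ⊆
      Icc (fun j => lo j + 1 / ((k : ℝ) + 1)) (fun j => hi j - 1 / ((k : ℝ) + 1)) := by
    intro k
    refine closure_minimal (fun z hz => ?_) isClosed_Icc
    have hz' : ∀ j, F k j (z j) ≠ 0 := fun j hj =>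
      hz (Finset.prod_eq_zero (Finset.mem_univ j) hj)
    have hj := fun j => mem_Icc_of_cutoff_ne_zero (by positivity) (left_ne_zero_of_mul (hz' j))
    exact ⟨fun j => (hj j).1, fun j => (hj j).2⟩
  have hsub : ∀ k : ℕ, Icc (fun j => lo j + 1 / ((k : ℝ) + 1)) (fun j => hi j - 1 / ((k : ℝ) + 1)) ⊆
      openBox lo hi := fun k z hz => mem_openBox.2 fun j => by
    have hp : 0 < 1 / ((k : ℝ) + 1) := by positivity
    have h1 := hz.1 j
    have h2 := hz.2 j
    simp only at h1 h2
    constructor <;> linarith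
  have hId : ∀ k, ∫ z in openBox lo hi, u z * partialDeriv i (tensor (F k)) z =
      -∫ z in openBox lo hi, v z * tensor (F k) z := fun k =>
    huv _ (contDiff_tensor (hFs k))
      (isCompact_Icc.of_isClosed_subset (isClosed_tsupport _) (hsupp k))
      ((hsupp k).trans (hsub k))
  have hev : ∀ z ∈ openBox lo hi, ∀ j, ∀ᶠ k in atTop, F k j =ᶠ[𝓝 (z j)] f j := fun z hz j => by
    filter_upwards [eventually_cutoff_eq_one (mem_openBox.1 hz j)] with k hk
    filter_upwards [hk] with s hs
    simp [hF, hs]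
  have lim1 : Tendsto (fun k => ∫ z in openBox lo hi, v z * tensor (F k) z) atTop
      (𝓝 (∫ z in openBox lo hi, v z * tensor f z)) := by
    refine tendsto_integral_of_dominated_convergence (fun z => |v z| * ∏ j, C j) (fun k => ?_)
      (hv.abs.mul_const _) (fun k => ?_) ?_
    · exact hv.aestronglyMeasurable.mul (contDiff_tensor (hFs k)).continuous.aestronglyMeasurable
    · refine (ae_restrict_iff' measurableSet_openBox).2 (.of_forall fun z hz => ?_)
      rw [norm_mul, Real.norm_eq_abs, Real.norm_eq_abs, tensor, Finset.abs_prod]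
      gcongr with j
      exact hFC k j _ (mem_openBox.1 hz j)
    · refine (ae_restrict_iff' measurableSet_openBox).2 (.of_forall fun z hz => ?_)
      refine tendsto_const_nhds.congr' ?_
      filter_upwards [eventually_all.2 (hev z hz)] with k hk
      congr 1
      exact Finset.prod_congr rfl fun j _ => ((hk j).eq_of_nhds).symm
  have lim2 : Tendsto (fun k => ∫ z in openBox lo hi, u z * partialDeriv i (tensor (F k)) z) atTop
      (𝓝 (∫ z in openBox lo hi, u z * partialDeriv i (tensor f) z)) := by
    refine tendsto_integral_of_dominated_convergence
      (fun z => |u z| * (C' * ∏ j ∈ Finset.univ.erase i, C j)) (fun k => ?_)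
      (hu.abs.mul_const _) (fun k => ?_) ?_
    · exact hu.aestronglyMeasurable.mul
        (continuous_partialDeriv (contDiff_tensor (hFs1 k)) i).aestronglyMeasurable
    · refine (ae_restrict_iff' measurableSet_openBox).2 (.of_forall fun z hz => ?_)
      rw [norm_mul, Real.norm_eq_abs, Real.norm_eq_abs, partialDeriv_tensor (hFs1 k),
        tensor_update, abs_mul, Finset.abs_prod]
      have h1 := hC' k _ (mem_openBox.1 hz i)
      have h2 : 0 ≤ C' := (abs_nonneg _).trans h1
      gcongr with j
      exact hFC k j _ (mem_openBox.1 hz j)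
    · refine (ae_restrict_iff' measurableSet_openBox).2 (.of_forall fun z hz => ?_)
      refine tendsto_const_nhds.congr' ?_
      filter_upwards [eventually_all.2 (hev z hz)] with k hk
      rw [partialDeriv_tensor (hFs1 k), partialDeriv_tensor hf1, tensor_update, tensor_update,
        (hk i).deriv_eq]
      congr 2
      exact Finset.prod_congr rfl fun j _ => ((hk j).eq_of_nhds).symm
  exact tendsto_nhds_unique (lim2.congr hId) lim1.neg

/-! ### Cosine modes -/

/-- The function `s ↦ cos (kπ (s - a) / (b - a))`. -/
noncomputable def cosMode₁ (a b : ℝ) (k : ℤ) (s : ℝ) : ℝ :=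
  Real.cos (k * (Real.pi / (b - a)) * (s - a))

/-- The Neumann eigenfunctions `z ↦ ∏ⱼ cos (kⱼπ (zⱼ - loⱼ) / (hiⱼ - loⱼ))` of the box. -/
noncomputable def cosMode {n : ℕ} (lo hi : Fin n → ℝ) (k : Fin n → ℤ) : (Fin n → ℝ) → ℝ :=
  tensor fun j => cosMode₁ (lo j) (hi j) (k j)

section CosMode

theorem contDiff_cosMode₁ {a b : ℝ} {k : ℤ} {m : WithTop ℕ∞} : ContDiff ℝ m (cosMode₁ a b k) :=
  Real.contDiff_cos.comp (contDiff_const.mul (contDiff_id.sub contDiff_const))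

theorem deriv_cosMode₁ (a b : ℝ) (k : ℤ) : deriv (cosMode₁ a b k) = fun s =>
    -(k * (Real.pi / (b - a))) * Real.sin (k * (Real.pi / (b - a)) * (s - a)) := by
  ext s
  have := (Real.hasDerivAt_cos (k * (Real.pi / (b - a)) * (s - a))).comp s
    (((hasDerivAt_id s).sub_const a).const_mul (k * (Real.pi / (b - a))))
  exact (this.congr_deriv (by simp; ring)).deriv

theorem deriv_deriv_cosMode₁ (a b : ℝ) (k : ℤ) :
    deriv (deriv (cosMode₁ a b k)) =
      fun s => -(k * (Real.pi / (b - a))) ^ 2 * cosMode₁ a b k s := by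
  rw [deriv_cosMode₁]
  ext s
  have := ((Real.hasDerivAt_sin (k * (Real.pi / (b - a)) * (s - a))).comp s
    (((hasDerivAt_id s).sub_const a).const_mul (k * (Real.pi / (b - a))))).const_mul
      (-(k * (Real.pi / (b - a))))
  exact (this.congr_deriv (by simp [cosMode₁]; ring)).deriv

theorem deriv_cosMode₁_left (a b : ℝ) (k : ℤ) : deriv (cosMode₁ a b k) a = 0 := by
  simp [deriv_cosMode₁]

/-- The Neumann condition makes the derivative of a mode admissible as the `i`-th factor in
`HasWeakPartial.integral_tensor`. -/
theorem deriv_cosMode₁_right {a b : ℝ} (h : a < b) (k : ℤ) : deriv (cosMode₁ a b k) b = 0 := by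
  have : b - a ≠ 0 := (sub_pos.2 h).ne'
  rw [deriv_cosMode₁]
  simp only
  rw [mul_assoc, div_mul_cancel₀ _ this, Real.sin_int_mul_pi, mul_zero]

theorem contDiff_deriv_cosMode₁ {a b : ℝ} {k : ℤ} {m : WithTop ℕ∞} :
    ContDiff ℝ m (deriv (cosMode₁ a b k)) := by
  rw [deriv_cosMode₁]
  exact contDiff_const.mul
    (Real.contDiff_sin.comp (contDiff_const.mul (contDiff_id.sub contDiff_const)))

variable {n : ℕ} {lo hi : Fin n → ℝ}

theorem contDiff_cosMode {k : Fin n → ℤ} {m : WithTop ℕ∞} : ContDiff ℝ m (cosMode lo hi k) :=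
  contDiff_tensor fun _ => contDiff_cosMode₁

/-- The product-to-sum formula is applied in each coordinate. Expanding the product of the resulting
sums gives one term per set `t` of coordinates in which the frequencies are added. Integer
frequencies allow differences of either sign. -/
theorem cosMode_mul (k l : Fin n → ℤ) : cosMode lo hi k * cosMode lo hi l =
    ∑ t : Finset (Fin n), (2⁻¹ : ℝ) ^ n • cosMode lo hi (t.piecewise (k + l) (k - l)) := by
  ext z
  have h : ∀ j, cosMode₁ (lo j) (hi j) (k j) (z j) * cosMode₁ (lo j) (hi j) (l j) (z j) =
      2⁻¹ * (cosMode₁ (lo j) (hi j) ((k + l) j) (z j) +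
        cosMode₁ (lo j) (hi j) ((k - l) j) (z j)) := fun j => by
    simp only [cosMode₁, Pi.add_apply, Pi.sub_apply, Int.cast_add, Int.cast_sub, add_mul, sub_mul,
      Real.cos_add, Real.cos_sub]
    ring
  simp only [Pi.mul_apply, cosMode, tensor, Finset.sum_apply, Pi.smul_apply, smul_eq_mul]
  rw [← Finset.prod_mul_distrib, Finset.prod_congr rfl fun j _ => h j, Finset.prod_mul_distrib,
    Finset.prod_const, Finset.card_univ, Fintype.card_fin, Fintype.prod_add, Finset.mul_sum]
  refine Finset.sum_congr rfl fun t _ => ?_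
  congr 1
  rw [← Finset.prod_mul_prod_compl t]
  congr 1
  · exact Finset.prod_congr rfl fun j hj => by rw [Finset.piecewise_eq_of_mem _ _ _ hj]
  · exact Finset.prod_congr rfl fun j hj => by
      rw [Finset.piecewise_eq_of_notMem _ _ _ (Finset.mem_compl.1 hj)]

/-- The algebra of cosine polynomials on the box. -/
noncomputable def cosAlg (lo hi : Fin n → ℝ) : Subalgebra ℝ ((Fin n → ℝ) → ℝ) :=
  (Submodule.span ℝ (range (cosMode lo hi))).toSubalgebra
    (Submodule.subset_span ⟨0, by ext z; simp [cosMode, tensor, cosMode₁]⟩)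
    (fun x y hx hy => by
      have h := Submodule.mul_mem_mul hx hy
      rw [Submodule.span_mul_span] at h
      refine (Submodule.span_le.2 ?_) h
      rintro _ ⟨_, ⟨k, rfl⟩, _, ⟨l, rfl⟩, rfl⟩
      simp only [cosMode_mul]
      exact Submodule.sum_mem _ fun t _ =>
        Submodule.smul_mem _ _ (Submodule.subset_span ⟨_, rfl⟩))

theorem mem_cosAlg {p : (Fin n → ℝ) → ℝ} :
    p ∈ cosAlg lo hi ↔ p ∈ Submodule.span ℝ (range (cosMode lo hi)) := Iff.rfl

theorem contDiff_of_mem_cosAlg {p : (Fin n → ℝ) → ℝ} (hp : p ∈ cosAlg lo hi) {m : WithTop ℕ∞} :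
    ContDiff ℝ m p := by
  rw [mem_cosAlg] at hp
  induction hp using Submodule.span_induction with
  | mem f hf => obtain ⟨k, rfl⟩ := hf; exact contDiff_cosMode
  | zero => exact contDiff_const
  | add f g _ _ hf hg => exact hf.add hg
  | smul c f _ hf => exact contDiff_const.smul hf

/-- Stone–Weierstrass on the closed box. The lowest mode in direction `j` separates points differing
in the `j`-th coordinate, as the cosine is injective on `[0, π]`. -/
theorem exists_cosAlg_near (hlt : ∀ j, lo j < hi j) {f : (Fin n → ℝ) → ℝ} (hf : Continuous f)
    {δ : ℝ} (hδ : 0 < δ) : ∃ p ∈ cosAlg lo hi, ∀ z ∈ Icc lo hi, |p z - f z| ≤ δ := by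
  let A : Subalgebra ℝ C(Icc lo hi, ℝ) :=
    { carrier := {g | ∃ p ∈ cosAlg lo hi, ∀ x, g x = p x}
      mul_mem' := by
        rintro g g' ⟨p, hp, h⟩ ⟨p', hp', h'⟩
        exact ⟨p * p', (cosAlg lo hi).mul_mem hp hp', fun x => by simp [h, h']⟩
      add_mem' := by
        rintro g g' ⟨p, hp, h⟩ ⟨p', hp', h'⟩
        exact ⟨p + p', (cosAlg lo hi).add_mem hp hp', fun x => by simp [h, h']⟩
      algebraMap_mem' := fun c => ⟨algebraMap ℝ _ c, (cosAlg lo hi).algebraMap_mem c, fun x => by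
        simp⟩ }
  have hA : A.SeparatesPoints := by
    intro x y hxy
    obtain ⟨j, hj⟩ := Function.ne_iff.1 (fun h => hxy (Subtype.ext h))
    refine ⟨_, ⟨⟨fun x => cosMode lo hi (Pi.single j 1) x,
      (contDiff_cosMode (m := 0)).continuous.comp continuous_subtype_val⟩,
      ⟨_, Submodule.subset_span ⟨Pi.single j 1, rfl⟩, fun _ => rfl⟩, rfl⟩, fun h => hj ?_⟩
    have e : ∀ z, cosMode lo hi (Pi.single j 1) z =
        Real.cos (Real.pi / (hi j - lo j) * (z j - lo j)) := fun z => by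
      unfold cosMode tensor
      rw [Finset.prod_eq_single j]
      · simp [cosMode₁]
      · intro i _ hi
        simp [cosMode₁, hi]
      · simp
    have hL : 0 < hi j - lo j := sub_pos.2 (hlt j)
    have hmem : ∀ x : Icc lo hi, Real.pi / (hi j - lo j) * (x.1 j - lo j) ∈ Icc 0 Real.pi := by
      intro x
      have h1 := x.2.1 j
      have h2 := x.2.2 j
      refine ⟨mul_nonneg (by positivity) (by linarith), ?_⟩
      rw [div_mul_eq_mul_div, div_le_iff₀ hL]
      gcongr
    simp only [ContinuousMap.coe_mk, e] at h
    have := Real.injOn_cos (hmem x) (hmem y) h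
    have hne : Real.pi / (hi j - lo j) ≠ 0 := by positivity
    linarith [mul_left_cancel₀ hne this]
  obtain ⟨⟨g, p, hp, hg⟩, hgf⟩ :=
    ContinuousMap.exists_mem_subalgebra_near_continuous_of_separatesPoints A hA
      (fun x : Icc lo hi => f x) (hf.comp continuous_subtype_val) δ hδ
  refine ⟨p, hp, fun z hz => ?_⟩
  have := (hgf ⟨z, hz⟩).le
  simpa [hg] using this

/-- The cosine modes are complete. -/
theorem ae_eq_zero_of_forall_integral_cosMode (hlt : ∀ j, lo j < hi j) {u : (Fin n → ℝ) → ℝ}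
    (hu : Integrable u (volume.restrict (openBox lo hi)))
    (h : ∀ k, ∫ z in openBox lo hi, u z * cosMode lo hi k z = 0) :
    u =ᵐ[volume.restrict (openBox lo hi)] 0 := by
  have hui : ∀ f : (Fin n → ℝ) → ℝ, Continuous f →
      Integrable (fun z => u z * f z) (volume.restrict (openBox lo hi)) := fun f hf => by
    obtain ⟨C, hC⟩ :=
      (isCompact_Icc (a := lo) (b := hi)).exists_bound_of_continuousOn hf.continuousOn
    exact hu.mul_bdd (c := C) hf.aestronglyMeasurable ((ae_restrict_iff' measurableSet_openBox).2
      (.of_forall fun z hz => hC z (openBox_subset_Icc hz)))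
  have hp : ∀ p ∈ cosAlg lo hi, ∫ z in openBox lo hi, u z * p z = 0 := by
    intro p hp
    rw [mem_cosAlg] at hp
    induction hp using Submodule.span_induction with
    | mem f hf => obtain ⟨k, rfl⟩ := hf; exact h k
    | zero => simp
    | add f g hf hg hf' hg' =>
      simp only [Pi.add_apply, mul_add]
      rw [integral_add (hui f (contDiff_of_mem_cosAlg (m := 0) hf).continuous)
        (hui g (contDiff_of_mem_cosAlg (m := 0) hg).continuous), hf', hg', add_zero]
    | smul c f _ hf =>
      simp only [Pi.smul_apply, smul_eq_mul, mul_left_comm _ c]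
      rw [integral_const_mul, hf, mul_zero]
  have hc : ∀ f : (Fin n → ℝ) → ℝ, Continuous f → ∫ z in openBox lo hi, u z * f z = 0 := by
    intro f hf
    -- Since `u` annihilates cosine polynomials, `f` may be replaced by its error of uniform
    -- approximation, which is arbitrarily small.
    have hb : ∀ δ > 0, |∫ z in openBox lo hi, u z * f z| ≤ (∫ z in openBox lo hi, |u z|) * δ := by
      intro δ hδ
      obtain ⟨p, hpA, hpf⟩ := exists_cosAlg_near hlt hf hδ
      have hpc := (contDiff_of_mem_cosAlg (m := 0) hpA).continuous
      have e : ∫ z in openBox lo hi, u z * f z = -∫ z in openBox lo hi, u z * (p z - f z) := by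
        simp only [mul_sub]
        rw [integral_sub (hui p hpc) (hui f hf), hp p hpA]; ring
      rw [e, abs_neg, ← integral_mul_const]
      refine (norm_integral_le_integral_norm _).trans (setIntegral_mono_on
        (hui _ (hpc.sub hf)).norm (hu.abs.mul_const δ) measurableSet_openBox fun z hz => ?_)
      rw [norm_mul, Real.norm_eq_abs, Real.norm_eq_abs]
      gcongr
      exact hpf z (openBox_subset_Icc hz)
    have hlim : Tendsto (fun δ => (∫ z in openBox lo hi, |u z|) * δ) (𝓝[>] 0) (𝓝 0) := by
      have : Tendsto (fun δ => (∫ z in openBox lo hi, |u z|) * δ) (𝓝 0)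
          (𝓝 ((∫ z in openBox lo hi, |u z|) * 0)) := tendsto_id.const_mul _
      rw [mul_zero] at this
      exact this.mono_left nhdsWithin_le_nhds
    exact abs_nonpos_iff.1 (ge_of_tendsto hlim (eventually_mem_nhdsWithin.mono hb))
  refine (ae_restrict_iff' measurableSet_openBox).2
    (isOpen_openBox.ae_eq_zero_of_integral_contDiff_smul_eq_zero
      (IntegrableOn.locallyIntegrableOn hu) fun g hg _ hgs => ?_)
  rw [← setIntegral_eq_integral_of_forall_compl_eq_zero (s := openBox lo hi)]
  · simpa [mul_comm] using hc g hg.continuous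
  · intro x hx
    rw [image_eq_zero_of_notMem_tsupport fun h => hx (hgs h), zero_smul]

end CosMode

/-- Classical partial derivatives are weak partial derivatives. -/
theorem integral_mul_partialDeriv_eq_neg {n : ℕ} {U : Set (Fin n → ℝ)} {p ψ : (Fin n → ℝ) → ℝ}
    (hp : ContDiff ℝ 1 p) (hψ : ContDiff ℝ 1 ψ) (hc : HasCompactSupport ψ) (hU : tsupport ψ ⊆ U)
    (i : Fin n) :
    ∫ z in U, p z * partialDeriv i ψ z = -∫ z in U, partialDeriv i p z * ψ z := by
  have hc' : HasCompactSupport (partialDeriv i ψ) := hc.fderiv_apply (𝕜 := ℝ) _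
  have hs : tsupport (partialDeriv i ψ) ⊆ tsupport ψ := tsupport_fderiv_apply_subset ℝ _
  have hcp := continuous_partialDeriv hp i
  have hcψ := continuous_partialDeriv hψ i
  rw [setIntegral_eq_integral_of_forall_compl_eq_zero,
    setIntegral_eq_integral_of_forall_compl_eq_zero]
  · exact integral_mul_fderiv_eq_neg_fderiv_mul_of_integrable
      ((hcp.mul hψ.continuous).integrable_of_hasCompactSupport hc.mul_left)
      ((hp.continuous.mul hcψ).integrable_of_hasCompactSupport hc'.mul_left)
      ((hp.continuous.mul hψ.continuous).integrable_of_hasCompactSupport hc.mul_left)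
      (fun x _ => hp.differentiable one_ne_zero x) (fun x _ => hψ.differentiable one_ne_zero x)
  · intro x hx
    rw [image_eq_zero_of_notMem_tsupport fun h => hx (hU h), mul_zero]
  · intro x hx
    rw [image_eq_zero_of_notMem_tsupport fun h => hx (hU (hs h)), mul_zero]

/-! ### Density of cosine polynomials in `H¹` -/

section Jets

variable {n : ℕ} {lo hi : Fin n → ℝ}

/-- The space `L²(B)ⁿ⁺¹` of a function and its partial derivatives. -/
abbrev JetSpace (lo hi : Fin n → ℝ) :=
  PiLp 2 fun _ : Option (Fin n) => Lp ℝ 2 (volume.restrict (openBox lo hi))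

/-- The element of the jet space given by `u` and `v`. -/
noncomputable def jet {u : (Fin n → ℝ) → ℝ} {v : Fin n → (Fin n → ℝ) → ℝ}
    (hu : MemLp u 2 (volume.restrict (openBox lo hi)))
    (hv : ∀ i, MemLp (v i) 2 (volume.restrict (openBox lo hi))) : JetSpace lo hi :=
  WithLp.toLp 2 fun o => o.elim hu.toLp fun i => (hv i).toLp

theorem inner_toLp {u u' : (Fin n → ℝ) → ℝ} (hu : MemLp u 2 (volume.restrict (openBox lo hi)))
    (hu' : MemLp u' 2 (volume.restrict (openBox lo hi))) :
    inner ℝ hu.toLp hu'.toLp = ∫ z in openBox lo hi, u z * u' z := by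
  rw [L2.inner_def]
  refine integral_congr_ae ?_
  filter_upwards [hu.coeFn_toLp, hu'.coeFn_toLp] with z h h'
  rw [h, h']
  simp [mul_comm]

theorem inner_jet {u u' : (Fin n → ℝ) → ℝ} {v v' : Fin n → (Fin n → ℝ) → ℝ}
    (hu : MemLp u 2 (volume.restrict (openBox lo hi)))
    (hv : ∀ i, MemLp (v i) 2 (volume.restrict (openBox lo hi)))
    (hu' : MemLp u' 2 (volume.restrict (openBox lo hi)))
    (hv' : ∀ i, MemLp (v' i) 2 (volume.restrict (openBox lo hi))) :
    inner ℝ (jet hu hv) (jet hu' hv') = (∫ z in openBox lo hi, u z * u' z) +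
      ∑ i, ∫ z in openBox lo hi, v i z * v' i z := by
  rw [PiLp.inner_apply, Fintype.sum_option]
  simp [jet, inner_toLp]

/-- The entries of an arbitrary element need not be related. Representing it by functions allows an
abstract orthogonal vector to be treated as a pair `u`, `v`. -/
theorem exists_eq_jet (d : JetSpace lo hi) :
    ∃ (u : (Fin n → ℝ) → ℝ) (v : Fin n → (Fin n → ℝ) → ℝ)
      (hu : MemLp u 2 (volume.restrict (openBox lo hi)))
      (hv : ∀ i, MemLp (v i) 2 (volume.restrict (openBox lo hi))), d = jet hu hv := by
  refine ⟨d none, fun i => d (some i), Lp.memLp _, fun i => Lp.memLp _, ?_⟩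
  ext1 o
  cases o <;> simp [jet]

/-- The jet of a `C¹` function. -/
noncomputable def jetOf {f : (Fin n → ℝ) → ℝ} (hf : ContDiff ℝ 1 f) : JetSpace lo hi :=
  jet (memLp_of_continuous hf.continuous 2)
    fun i => memLp_of_continuous (continuous_partialDeriv hf i) 2

/-- The vector expressing the weak derivative identity with test function `ψ`. -/
noncomputable def testJet (i : Fin n) {ψ : (Fin n → ℝ) → ℝ} (hψ : ContDiff ℝ ∞ ψ) :
    JetSpace lo hi :=
  jet (u := partialDeriv i ψ) (v := fun j => if j = i then ψ else 0)
    (memLp_of_continuous (continuous_partialDeriv (hψ.of_le (by simp)) i) 2) fun j => by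
      split_ifs
      · exact memLp_of_continuous hψ.continuous 2
      · exact MemLp.zero

theorem inner_testJet {u : (Fin n → ℝ) → ℝ} {v : Fin n → (Fin n → ℝ) → ℝ}
    (hu : MemLp u 2 (volume.restrict (openBox lo hi)))
    (hv : ∀ i, MemLp (v i) 2 (volume.restrict (openBox lo hi)))
    (i : Fin n) {ψ : (Fin n → ℝ) → ℝ} (hψ : ContDiff ℝ ∞ ψ) :
    inner ℝ (testJet i hψ) (jet hu hv) =
      (∫ z in openBox lo hi, u z * partialDeriv i ψ z) + ∫ z in openBox lo hi, v i z * ψ z := by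
  rw [testJet, inner_jet]
  congr 1
  · simp only [mul_comm]
  · rw [Finset.sum_eq_single i]
    · simp only [if_true, mul_comm]
    · intro j _ hj
      simp [hj]
    · simp

/-- The jets which satisfy the weak derivative identities. -/
noncomputable def weakJets (lo hi : Fin n → ℝ) : Submodule ℝ (JetSpace lo hi) :=
  (Submodule.span ℝ {d | ∃ (i : Fin n) (ψ : (Fin n → ℝ) → ℝ) (hψ : ContDiff ℝ ∞ ψ),
    HasCompactSupport ψ ∧ tsupport ψ ⊆ openBox lo hi ∧ d = testJet i hψ})ᗮ

/-- Each weak derivative identity is orthogonality to one test jet. The subspace is thus an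
orthogonal complement, hence closed, and the projection theorem applies. -/
theorem jet_mem_weakJets {u : (Fin n → ℝ) → ℝ} {v : Fin n → (Fin n → ℝ) → ℝ}
    (hu : MemLp u 2 (volume.restrict (openBox lo hi)))
    (hv : ∀ i, MemLp (v i) 2 (volume.restrict (openBox lo hi))) :
    jet hu hv ∈ weakJets lo hi ↔ ∀ (i : Fin n) (ψ : (Fin n → ℝ) → ℝ), ContDiff ℝ ∞ ψ →
      HasCompactSupport ψ → tsupport ψ ⊆ openBox lo hi →
      ∫ z in openBox lo hi, u z * partialDeriv i ψ z = -∫ z in openBox lo hi, v i z * ψ z := by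
  rw [weakJets, Submodule.mem_orthogonal]
  constructor
  · intro h i ψ hψ hc hs
    have := h _ (Submodule.subset_span ⟨i, ψ, hψ, hc, hs, rfl⟩)
    rw [inner_testJet] at this
    linarith
  · intro h d hd
    induction hd using Submodule.span_induction with
    | mem d hd =>
      obtain ⟨i, ψ, hψ, hc, hs, rfl⟩ := hd
      rw [inner_testJet, h i ψ hψ hc hs, neg_add_cancel]
    | zero => exact inner_zero_left _
    | add x y _ _ hx hy => rw [inner_add_left, hx, hy, add_zero]
    | smul c x _ hx => rw [inner_smul_left, hx, mul_zero]

/-- The span of the jets of the cosine modes. -/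
noncomputable def cosJets (lo hi : Fin n → ℝ) : Submodule ℝ (JetSpace lo hi) :=
  Submodule.span ℝ (range fun k : Fin n → ℤ => jetOf (contDiff_cosMode (lo := lo) (hi := hi) (k := k)))

/-- Taking the jet is linear on `C¹` functions, so a combination of mode jets is the jet of the
combined polynomial. -/
theorem exists_of_mem_cosJets {d : JetSpace lo hi} (hd : d ∈ cosJets lo hi) :
    ∃ p ∈ cosAlg lo hi, ∃ hp : ContDiff ℝ 1 p, d = jetOf hp := by
  induction hd using Submodule.span_induction with
  | mem d hd => obtain ⟨k, rfl⟩ := hd; exact ⟨_, Submodule.subset_span ⟨k, rfl⟩, _, rfl⟩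
  | zero =>
    refine ⟨0, Submodule.zero_mem _, contDiff_const, ?_⟩
    ext1 o
    cases o with
    | none => simp [jetOf, jet]
    | some i =>
      have : partialDeriv i (0 : (Fin n → ℝ) → ℝ) = 0 := by ext; simp [partialDeriv]
      simp [jetOf, jet, this]
  | add x y _ _ hx hy =>
    obtain ⟨p, hp, hpc, rfl⟩ := hx
    obtain ⟨q, hq, hqc, rfl⟩ := hy
    refine ⟨p + q, Submodule.add_mem _ hp hq, hpc.add hqc, ?_⟩
    ext1 o
    cases o with
    | none => exact (MemLp.toLp_add (memLp_of_continuous hpc.continuous 2)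
        (memLp_of_continuous hqc.continuous 2)).symm
    | some i =>
      refine (MemLp.toLp_add (memLp_of_continuous (continuous_partialDeriv hpc i) 2)
        (memLp_of_continuous (continuous_partialDeriv hqc i) 2)).symm.trans
        (MemLp.toLp_congr _ (memLp_of_continuous (continuous_partialDeriv (hpc.add hqc) i) 2)
          (.of_forall fun z => ?_))
      exact (partialDeriv_add (hpc.differentiable one_ne_zero z)
        (hqc.differentiable one_ne_zero z)).symm
  | smul c x _ hx =>
    obtain ⟨p, hp, hpc, rfl⟩ := hx
    refine ⟨c • p, Submodule.smul_mem _ c hp, contDiff_const.smul hpc, ?_⟩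
    ext1 o
    cases o with
    | none => exact (MemLp.toLp_const_smul c (memLp_of_continuous hpc.continuous 2)).symm
    | some i =>
      refine (MemLp.toLp_const_smul c
        (memLp_of_continuous (continuous_partialDeriv hpc i) 2)).symm.trans
        (MemLp.toLp_congr _ (memLp_of_continuous (continuous_partialDeriv
          (contDiff_const.smul hpc) i) 2) (.of_forall fun z => ?_))
      exact (partialDeriv_smul c (hpc.differentiable one_ne_zero z)).symm

theorem cosJets_closure_le_weakJets : (cosJets lo hi).topologicalClosure ≤ weakJets lo hi := by
  refine Submodule.topologicalClosure_minimal _ ?_ (Submodule.isClosed_orthogonal _)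
  rw [cosJets, Submodule.span_le]
  rintro _ ⟨k, rfl⟩
  exact (jet_mem_weakJets _ _).2 fun i ψ hψ hc hs =>
    integral_mul_partialDeriv_eq_neg contDiff_cosMode (hψ.of_le (by simp)) hc hs i

/-- A weak jet orthogonal to all cosine modes vanishes. -/
theorem eq_zero_of_mem_weakJets (hlt : ∀ j, lo j < hi j) {d : JetSpace lo hi}
    (hd : d ∈ weakJets lo hi) (hd' : d ∈ (cosJets lo hi)ᗮ) : d = 0 := by
  obtain ⟨u, v, hu, hv, rfl⟩ := exists_eq_jet d
  rw [jet_mem_weakJets] at hd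
  have hui := hu.integrable one_le_two
  have hvi := fun i => (hv i).integrable one_le_two
  have hmode : ∀ k, ∫ z in openBox lo hi, u z * cosMode lo hi k z = 0 := by
    intro k
    have h := (Submodule.mem_orthogonal _ _).1 hd' _ (Submodule.subset_span ⟨k, rfl⟩)
    beta_reduce at h
    rw [jetOf, inner_jet] at h
    -- The weak derivative identity is tested with `∂ᵢ` of the mode, a tensor product vanishing on
    -- the faces orthogonal to axis `i`. Differentiating once more returns the mode times minus its
    -- eigenvalue.
    have hkv : ∀ i, ∫ z in openBox lo hi, partialDeriv i (cosMode lo hi k) z * v i z =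
        (k i * (Real.pi / (hi i - lo i))) ^ 2 *
          ∫ z in openBox lo hi, u z * cosMode lo hi k z := by
      intro i
      have hf : ∀ j, ContDiff ℝ ∞ (Function.update (fun j => cosMode₁ (lo j) (hi j) (k j)) i
          (deriv (cosMode₁ (lo i) (hi i) (k i))) j) := by
        intro j
        rcases eq_or_ne j i with rfl | hj
        · rw [Function.update_self]; exact contDiff_deriv_cosMode₁
        · rw [Function.update_of_ne hj]; exact contDiff_cosMode₁
      have e1 : partialDeriv i (cosMode lo hi k) = tensor (Function.update
          (fun j => cosMode₁ (lo j) (hi j) (k j)) i (deriv (cosMode₁ (lo i) (hi i) (k i)))) :=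
        partialDeriv_tensor (fun j => contDiff_cosMode₁) i
      have h2 := HasWeakPartial.integral_tensor hlt hui (hvi i) (hd i) hf
        (by rw [Function.update_self]; exact deriv_cosMode₁_left _ _ _)
        (by rw [Function.update_self]; exact deriv_cosMode₁_right (hlt i) _)
      have e2 : partialDeriv i (tensor (Function.update
          (fun j => cosMode₁ (lo j) (hi j) (k j)) i (deriv (cosMode₁ (lo i) (hi i) (k i))))) =
          fun z => -(k i * (Real.pi / (hi i - lo i))) ^ 2 * cosMode lo hi k z := by
        rw [partialDeriv_tensor fun j => (hf j).of_le (by simp)]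
        ext z
        rw [Function.update_idem, Function.update_self, deriv_deriv_cosMode₁, tensor_update,
          cosMode, tensor, ← Finset.mul_prod_erase _ _ (Finset.mem_univ i)]
        ring
      rw [e1]
      simp only [mul_comm _ (v i _)]
      rw [← neg_eq_iff_eq_neg.2 h2, e2, ← integral_neg, ← integral_const_mul]
      congr 1
      ext z
      ring
    -- Orthogonality now reads `(1 + ∑ᵢ (kᵢπ/Lᵢ)²) ∫ u cₖ = 0` with a positive factor.
    simp only [hkv, mul_comm (cosMode lo hi k _)] at h
    rw [← Finset.sum_mul, ← one_add_mul] at h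
    refine (mul_eq_zero.1 h).resolve_left (ne_of_gt ?_)
    positivity
  have hu0 := ae_eq_zero_of_forall_integral_cosMode hlt hui hmode
  -- The weak derivatives of `u = 0` vanish against every test function.
  have hv0 : ∀ i, v i =ᵐ[volume.restrict (openBox lo hi)] 0 := by
    intro i
    refine (ae_restrict_iff' measurableSet_openBox).2
      (isOpen_openBox.ae_eq_zero_of_integral_contDiff_smul_eq_zero
        (IntegrableOn.locallyIntegrableOn (hvi i)) fun g hg hgc hgs => ?_)
    rw [← setIntegral_eq_integral_of_forall_compl_eq_zero (s := openBox lo hi)]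
    · have h1 := hd i g hg hgc hgs
      have h2 : ∫ z in openBox lo hi, u z * partialDeriv i g z = 0 := by
        refine integral_eq_zero_of_ae ?_
        filter_upwards [hu0] with z hz
        simp [hz]
      rw [h2] at h1
      simpa [mul_comm] using h1.symm
    · intro x hx
      rw [image_eq_zero_of_notMem_tsupport fun h => hx (hgs h), zero_smul]
  ext1 o
  cases o with
  | none => exact (MemLp.toLp_congr hu MemLp.zero hu0).trans (MemLp.toLp_zero _)
  | some i => exact (MemLp.toLp_congr (hv i) MemLp.zero (hv0 i)).trans (MemLp.toLp_zero _)

theorem integral_sq_sub_eq_norm_sq {u u' : (Fin n → ℝ) → ℝ} {v v' : Fin n → (Fin n → ℝ) → ℝ}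
    (hu : MemLp u 2 (volume.restrict (openBox lo hi)))
    (hv : ∀ i, MemLp (v i) 2 (volume.restrict (openBox lo hi)))
    (hu' : MemLp u' 2 (volume.restrict (openBox lo hi)))
    (hv' : ∀ i, MemLp (v' i) 2 (volume.restrict (openBox lo hi))) :
    (∫ z in openBox lo hi, (u z - u' z) ^ 2) + ∑ i, ∫ z in openBox lo hi, (v i z - v' i z) ^ 2 =
      ‖jet hu hv - jet hu' hv'‖ ^ 2 := by
  have e : jet hu hv - jet hu' hv' = jet (hu.sub hu') fun i => (hv i).sub (hv' i) := by
    ext1 o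
    cases o with
    | none => exact (MemLp.toLp_sub hu hu').symm
    | some i => exact (MemLp.toLp_sub (hv i) (hv' i)).symm
  rw [e, ← real_inner_self_eq_norm_sq, inner_jet]
  simp only [Pi.sub_apply, sq]

/-- Cosine polynomials are dense in `H¹` of a box. -/
theorem exists_cosAlg_H1_close (hlt : ∀ j, lo j < hi j) {u : (Fin n → ℝ) → ℝ}
    {v : Fin n → (Fin n → ℝ) → ℝ} (hu : MemLp u 2 (volume.restrict (openBox lo hi)))
    (hv : ∀ i, MemLp (v i) 2 (volume.restrict (openBox lo hi)))
    (huv : ∀ i, HasWeakPartial (openBox lo hi) i u (v i)) {δ : ℝ} (hδ : 0 < δ) :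
    ∃ p ∈ cosAlg lo hi, ∫ z in openBox lo hi, (p z - u z) ^ 2 ≤ δ ∧
      ∀ i, ∫ z in openBox lo hi, (partialDeriv i p z - v i z) ^ 2 ≤ δ := by
  have hmem : jet hu hv ∈ (cosJets lo hi).topologicalClosure := by
    have hW : jet hu hv ∈ weakJets lo hi :=
      (jet_mem_weakJets hu hv).2 fun i => (huv i).integral_eq
    -- The weak jets split into the closure of the cosine jets and its orthogonal complement within
    -- the weak jets; the second summand is zero.
    rw [← Submodule.sup_orthogonal_inf_of_hasOrthogonalProjection
      (cosJets_closure_le_weakJets (lo := lo) (hi := hi))] at hW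
    obtain ⟨a, ha, b, ⟨hb1, hb2⟩, hab⟩ := Submodule.mem_sup.1 hW
    have hb0 : b = 0 := eq_zero_of_mem_weakJets hlt hb2
      (Submodule.orthogonal_le (Submodule.le_topologicalClosure _) hb1)
    rw [← hab, hb0, add_zero]
    exact ha
  obtain ⟨d, hd, hdist⟩ := Metric.mem_closure_iff.1 hmem (Real.sqrt δ) (Real.sqrt_pos.2 hδ)
  obtain ⟨p, hp, hpc, rfl⟩ := exists_of_mem_cosJets hd
  have hle : ‖jetOf hpc - jet hu hv‖ ^ 2 ≤ δ := by
    rw [dist_eq_norm, ← norm_neg, neg_sub] at hdist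
    calc _ ≤ Real.sqrt δ ^ 2 := by gcongr
      _ = δ := Real.sq_sqrt hδ.le
  rw [jetOf, ← integral_sq_sub_eq_norm_sq] at hle
  have h0 : 0 ≤ ∫ z in openBox lo hi, (p z - u z) ^ 2 := by positivity
  have h1 : ∀ i, 0 ≤ ∫ z in openBox lo hi, (partialDeriv i p z - v i z) ^ 2 := fun i => by positivity
  refine ⟨p, hp, ?_, fun i => ?_⟩
  · linarith [Finset.sum_nonneg fun i (_ : i ∈ Finset.univ) => h1 i]
  · linarith [Finset.single_le_sum (fun i _ => h1 i) (Finset.mem_univ i)]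

end Jets

/-! ### Sequences converging to zero in `L²` -/

/-- The sequence `f` lies in `L²(μ)` and converges to zero there. -/
structure L2Null {α : Type*} [MeasurableSpace α] (μ : Measure α) (f : ℕ → α → ℝ) : Prop where
  memLp : ∀ k, MemLp (f k) 2 μ
  tendsto : Tendsto (fun k => ∫ x, f k x ^ 2 ∂μ) atTop (𝓝 0)

section L2Null

variable {α : Type*} [MeasurableSpace α] {μ : Measure α} {f g : ℕ → α → ℝ}

theorem L2Null.of_le (hf : ∀ k, MemLp (f k) 2 μ) {b : ℕ → ℝ} (hb : Tendsto b atTop (𝓝 0))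
    (h : ∀ k, ∫ x, f k x ^ 2 ∂μ ≤ b k) : L2Null μ f :=
  ⟨hf, squeeze_zero (fun _ => by positivity) h hb⟩

theorem L2Null.congr (hf : L2Null μ f) (h : ∀ k, f k =ᵐ[μ] g k) : L2Null μ g := by
  refine ⟨fun k => (memLp_congr_ae (h k)).1 (hf.memLp k), hf.tendsto.congr fun k => ?_⟩
  refine integral_congr_ae ?_
  filter_upwards [h k] with x hx
  rw [hx]

theorem L2Null.add (hf : L2Null μ f) (hg : L2Null μ g) : L2Null μ fun k x => f k x + g k x := by
  refine .of_le (b := fun k => 2 * (∫ x, f k x ^ 2 ∂μ) + 2 * ∫ x, g k x ^ 2 ∂μ)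
    (fun k => (hf.memLp k).add (hg.memLp k)) ?_ fun k => ?_
  · simpa using (hf.tendsto.const_mul 2).add (hg.tendsto.const_mul 2)
  · have h1 := (hf.memLp k).integrable_sq
    have h2 := (hg.memLp k).integrable_sq
    rw [← integral_const_mul, ← integral_const_mul,
      ← integral_add (h1.const_mul 2) (h2.const_mul 2)]
    refine integral_mono ((hf.memLp k).add (hg.memLp k)).integrable_sq
      ((h1.const_mul 2).add (h2.const_mul 2)) fun x => ?_
    nlinarith [sq_nonneg (f k x - g k x)]

theorem L2Null.const_mul (c : ℝ) (hf : L2Null μ f) : L2Null μ fun k x => c * f k x := by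
  refine .of_le (b := fun k => c ^ 2 * ∫ x, f k x ^ 2 ∂μ) (fun k => (hf.memLp k).const_mul c) ?_
    fun k => ?_
  · simpa using hf.tendsto.const_mul (c ^ 2)
  · simp only [mul_pow]
    rw [integral_const_mul]

theorem L2Null.sub (hf : L2Null μ f) (hg : L2Null μ g) : L2Null μ fun k x => f k x - g k x := by
  simpa [sub_eq_add_neg] using hf.add (hg.const_mul (-1))

theorem L2Null.mul_of_abs_le_one (hf : L2Null μ f) {c : α → ℝ} (hc : AEStronglyMeasurable c μ)
    (hc1 : ∀ x, |c x| ≤ 1) : L2Null μ fun k x => c x * f k x := by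
  have hle : ∀ k x, |c x * f k x| ≤ |f k x| := fun k x => by
    rw [abs_mul]; exact mul_le_of_le_one_left (abs_nonneg _) (hc1 x)
  have hm : ∀ k, MemLp (fun x => c x * f k x) 2 μ := fun k =>
    (hf.memLp k).mono (hc.mul (hf.memLp k).aestronglyMeasurable) (.of_forall (hle k))
  refine .of_le hm hf.tendsto fun k => ?_
  exact integral_mono (hm k).integrable_sq (hf.memLp k).integrable_sq fun x => sq_le_sq.2 (hle k x)

/-- Cauchy–Schwarz against the constant 1, read off from `∫ (m f - a)² ≥ 0`, with `m` the total mass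
and `a` the integral of `f`. -/
theorem sq_integral_le [IsFiniteMeasure μ] {f : α → ℝ} (hf : MemLp f 2 μ) :
    (∫ x, f x ∂μ) ^ 2 ≤ μ.real univ * ∫ x, f x ^ 2 ∂μ := by
  have hi := hf.integrable one_le_two
  have h2 := hf.integrable_sq
  set m := μ.real univ
  set a := ∫ x, f x ∂μ
  rcases (measureReal_nonneg (μ := μ) (s := univ)).eq_or_lt with h0 | hpos
  · have : μ = 0 := by
      rw [← Measure.measure_univ_eq_zero]
      exact (measureReal_eq_zero_iff).1 h0.symm
    simp [a, this]
  · have key : 0 ≤ ∫ x, (m * f x - a) ^ 2 ∂μ := integral_nonneg fun x => sq_nonneg _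
    have e : ∫ x, (m * f x - a) ^ 2 ∂μ = m * (m * (∫ x, f x ^ 2 ∂μ) - a ^ 2) := by
      have : ∀ x, (m * f x - a) ^ 2 = m ^ 2 * f x ^ 2 - 2 * m * a * f x + a ^ 2 := fun x => by ring
      simp only [this]
      have h3 : Integrable (fun x => m ^ 2 * f x ^ 2) μ := h2.const_mul _
      have h4 : Integrable (fun x => 2 * m * a * f x) μ := hi.const_mul _
      have h5 : Integrable (fun x => m ^ 2 * f x ^ 2 - 2 * m * a * f x) μ := h3.sub h4
      rw [integral_add h5 (integrable_const _), integral_sub h3 h4, integral_const_mul,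
        integral_const_mul, integral_const, smul_eq_mul]
      change m ^ 2 * _ - 2 * m * a * a + m * a ^ 2 = _
      ring
    rw [e] at key
    have := nonneg_of_mul_nonneg_right key hpos
    linarith

end L2Null

/-! ### Slicing boxes -/

section Slice

variable {n : ℕ} {lo hi : Fin (n + 1) → ℝ} {i : Fin (n + 1)}

theorem continuous_onPlane : Continuous fun q : ℝ × (Fin n → ℝ) => onPlane i q.1 q.2 :=
  Continuous.finInsertNth i continuous_fst continuous_snd

@[simp] theorem removeNth_onPlane (i : Fin (n + 1)) (s : ℝ) (y : Fin n → ℝ) :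
    i.removeNth (onPlane i s y) = y :=
  Fin.removeNth_insertNth (α := fun _ => ℝ) i s y

@[simp] theorem onPlane_removeNth (i : Fin (n + 1)) (z : Fin (n + 1) → ℝ) :
    onPlane i (z i) (i.removeNth z) = z := Fin.insertNth_self_removeNth i z

theorem onPlane_mem_openBox {s : ℝ} {y : Fin n → ℝ} :
    onPlane i s y ∈ openBox lo hi ↔ s ∈ Ioo (lo i) (hi i) ∧ y ∈ face lo hi i := by
  simp only [face, mem_openBox]
  rw [Fin.forall_iff_succAbove i]
  simp [onPlane, Fin.removeNth]

/-- This is the form of Fubini behind both velocity averages (`i` the angular axis) and traces (`i`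
normal to a face). -/
theorem measurePreserving_slice (lo hi : Fin (n + 1) → ℝ) (i : Fin (n + 1)) :
    MeasurePreserving (MeasurableEquiv.piFinSuccAbove (fun _ => ℝ) i)
      (volume.restrict (openBox lo hi))
      ((volume.restrict (Ioo (lo i) (hi i))).prod (volume.restrict (face lo hi i))) := by
  have h := (volume_preserving_piFinSuccAbove (fun _ : Fin (n + 1) => ℝ) i).restrict_preimage_emb
    (MeasurableEquiv.measurableEmbedding _) (Ioo (lo i) (hi i) ×ˢ face lo hi i)
  rw [Measure.prod_restrict]
  have e : (MeasurableEquiv.piFinSuccAbove (fun _ => ℝ) i) ⁻¹' (Ioo (lo i) (hi i) ×ˢ face lo hi i) =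
      openBox lo hi := by
    ext z
    rw [← onPlane_removeNth i z, onPlane_mem_openBox]
    simp [MeasurableEquiv.piFinSuccAbove, Fin.insertNthEquiv]
  rw [e] at h
  exact h

theorem measurePreserving_slice_symm (lo hi : Fin (n + 1) → ℝ) (i : Fin (n + 1)) :
    MeasurePreserving (fun q : ℝ × (Fin n → ℝ) => onPlane i q.1 q.2)
      ((volume.restrict (Ioo (lo i) (hi i))).prod (volume.restrict (face lo hi i)))
      (volume.restrict (openBox lo hi)) :=
  (measurePreserving_slice lo hi i).symm _

theorem measurableEmbedding_onPlane :
    MeasurableEmbedding fun q : ℝ × (Fin n → ℝ) => onPlane i q.1 q.2 :=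
  (MeasurableEquiv.piFinSuccAbove (fun _ => ℝ) i).symm.measurableEmbedding

theorem integral_slice {F : (Fin (n + 1) → ℝ) → ℝ}
    (hF : Integrable F (volume.restrict (openBox lo hi))) :
    ∫ z in openBox lo hi, F z =
      ∫ y in face lo hi i, ∫ s in Ioo (lo i) (hi i), F (onPlane i s y) := by
  have h := measurePreserving_slice_symm lo hi i
  rw [← h.integral_comp measurableEmbedding_onPlane]
  exact integral_prod_symm _ ((h.integrable_comp_emb measurableEmbedding_onPlane).2 hF)

theorem memLp_removeNth {g : (Fin n → ℝ) → ℝ} {p : ENNReal}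
    (hg : MemLp g p (volume.restrict (face lo hi i))) :
    MemLp (fun z => g (i.removeNth z)) p (volume.restrict (openBox lo hi)) :=
  (hg.comp_snd (volume.restrict (Ioo (lo i) (hi i)))).comp_measurePreserving
    (measurePreserving_slice lo hi i)

theorem integral_removeNth {g : (Fin n → ℝ) → ℝ} (hlt : lo i ≤ hi i)
    (hg : Integrable g (volume.restrict (face lo hi i))) :
    ∫ z in openBox lo hi, g (i.removeNth z) = (hi i - lo i) * ∫ y in face lo hi i, g y := by
  have h := memLp_removeNth (lo := lo) (hi := hi) (memLp_one_iff_integrable.2 hg)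
  rw [integral_slice (i := i) (memLp_one_iff_integrable.1 h), ← integral_const_mul]
  refine integral_congr_ae (.of_forall fun y => ?_)
  simp [hlt]

/-- The integral along the `i`-th axis. -/
noncomputable def fiberIntegral (lo hi : Fin (n + 1) → ℝ) (i : Fin (n + 1))
    (F : (Fin (n + 1) → ℝ) → ℝ) (y : Fin n → ℝ) : ℝ :=
  ∫ s in Ioo (lo i) (hi i), F (onPlane i s y)

theorem integrable_fiberIntegral {F : (Fin (n + 1) → ℝ) → ℝ}
    (hF : Integrable F (volume.restrict (openBox lo hi))) :
    Integrable (fiberIntegral lo hi i F) (volume.restrict (face lo hi i)) := by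
  have h := (measurePreserving_slice_symm lo hi i).integrable_comp_emb
    measurableEmbedding_onPlane |>.2 hF
  exact h.integral_prod_right

theorem ae_memLp_slice {F : (Fin (n + 1) → ℝ) → ℝ}
    (hF : MemLp F 2 (volume.restrict (openBox lo hi))) :
    ∀ᵐ y ∂volume.restrict (face lo hi i),
      MemLp (fun s => F (onPlane i s y)) 2 (volume.restrict (Ioo (lo i) (hi i))) := by
  have hmp := measurePreserving_slice_symm lo hi i
  have h := (hF.comp_measurePreserving hmp)
  filter_upwards [h.integrable_sq.prod_left_ae, h.aestronglyMeasurable.prod_swap.prodMk_left] with y h1 h2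
  exact (memLp_two_iff_integrable_sq h2).2 h1

theorem fiberIntegral_sub_ae {F G : (Fin (n + 1) → ℝ) → ℝ}
    (hF : MemLp F 2 (volume.restrict (openBox lo hi)))
    (hG : MemLp G 2 (volume.restrict (openBox lo hi))) :
    fiberIntegral lo hi i (fun z => F z - G z) =ᵐ[volume.restrict (face lo hi i)]
      fun y => fiberIntegral lo hi i F y - fiberIntegral lo hi i G y := by
  filter_upwards [ae_memLp_slice (i := i) hF, ae_memLp_slice (i := i) hG] with y h1 h2
  exact integral_sub (h1.integrable one_le_two) (h2.integrable one_le_two)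

theorem sq_fiberIntegral_le_ae (hlt : lo i ≤ hi i) {F : (Fin (n + 1) → ℝ) → ℝ}
    (hF : MemLp F 2 (volume.restrict (openBox lo hi))) :
    ∀ᵐ y ∂volume.restrict (face lo hi i),
      fiberIntegral lo hi i F y ^ 2 ≤ (hi i - lo i) * fiberIntegral lo hi i (fun z => F z ^ 2) y := by
  filter_upwards [ae_memLp_slice (i := i) hF] with y hy
  have := sq_integral_le hy
  rwa [measureReal_restrict_apply_univ, Real.volume_real_Ioo_of_le hlt] at this

theorem memLp_fiberIntegral (hlt : lo i ≤ hi i) {F : (Fin (n + 1) → ℝ) → ℝ}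
    (hF : MemLp F 2 (volume.restrict (openBox lo hi))) :
    MemLp (fiberIntegral lo hi i F) 2 (volume.restrict (face lo hi i)) := by
  have hm := (integrable_fiberIntegral (i := i) (hF.integrable one_le_two)).aestronglyMeasurable
  refine (memLp_two_iff_integrable_sq hm).2
    (((integrable_fiberIntegral (i := i) hF.integrable_sq).const_mul (hi i - lo i)).mono'
      (hm.pow 2) ?_)
  filter_upwards [sq_fiberIntegral_le_ae hlt hF] with y hy
  rwa [Real.norm_eq_abs, abs_of_nonneg (sq_nonneg _)]

/-- Integration along an axis is bounded on `L²`, by Cauchy–Schwarz on almost every fiber and then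
Fubini. -/
theorem L2Null.fiberIntegral (hlt : lo i ≤ hi i) {F : ℕ → (Fin (n + 1) → ℝ) → ℝ}
    (hF : L2Null (volume.restrict (openBox lo hi)) F) :
    L2Null (volume.restrict (face lo hi i)) fun k => fiberIntegral lo hi i (F k) := by
  refine .of_le (b := fun k => (hi i - lo i) * ∫ z in openBox lo hi, F k z ^ 2)
    (fun k => memLp_fiberIntegral hlt (hF.memLp k)) ?_ fun k => ?_
  · simpa using hF.tendsto.const_mul (hi i - lo i)
  · rw [integral_slice (i := i) (hF.memLp k).integrable_sq, ← integral_const_mul]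
    exact integral_mono_ae (memLp_fiberIntegral hlt (hF.memLp k)).integrable_sq
      ((integrable_fiberIntegral (i := i) (hF.memLp k).integrable_sq).const_mul _)
      (sq_fiberIntegral_le_ae hlt (hF.memLp k))

theorem L2Null.removeNth (hlt : lo i ≤ hi i) {g : ℕ → (Fin n → ℝ) → ℝ}
    (hg : L2Null (volume.restrict (face lo hi i)) g) :
    L2Null (volume.restrict (openBox lo hi)) fun k z => g k (i.removeNth z) := by
  refine .of_le (b := fun k => (hi i - lo i) * ∫ y in face lo hi i, g k y ^ 2)
    (fun k => memLp_removeNth (hg.memLp k)) ?_ fun k => ?_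
  · simpa using hg.tendsto.const_mul (hi i - lo i)
  · exact (integral_removeNth hlt (hg.memLp k).integrable_sq).le

end Slice

/-! ### Convergence of traces -/

section Trace

variable {n : ℕ} {lo hi : Fin (n + 1) → ℝ} {i : Fin (n + 1)}

theorem hasDerivAt_onPlane {v : (Fin (n + 1) → ℝ) → ℝ} (hv : ContDiff ℝ 1 v) (s : ℝ)
    (y : Fin n → ℝ) :
    HasDerivAt (fun s => v (onPlane i s y)) (partialDeriv i v (onPlane i s y)) s := by
  have e : ∀ s, Function.update (onPlane i 0 y) i s = onPlane i s y := fun s => by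
    simp [onPlane]
  have h := hasDerivAt_comp_update (u := v) (z := onPlane i 0 y) (i := i) (s := s)
    (hv.differentiable one_ne_zero _)
  simpa only [e] using h

/-- The fundamental theorem of calculus along the fiber, with the integral of `|∂ᵢv|` enlarged to
the whole fiber before Cauchy–Schwarz. The bound does not depend on `s`, so it can be integrated
over the box. -/
theorem sq_sub_onPlane_le {v : (Fin (n + 1) → ℝ) → ℝ} (hv : ContDiff ℝ 1 v) {c s : ℝ}
    (hc : c ∈ Icc (lo i) (hi i)) (hs : s ∈ Icc (lo i) (hi i)) (y : Fin n → ℝ) :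
    (v (onPlane i c y) - v (onPlane i s y)) ^ 2 ≤
      (hi i - lo i) * fiberIntegral lo hi i (fun z => partialDeriv i v z ^ 2) y := by
  have hlt : lo i ≤ hi i := hc.1.trans hc.2
  have hcont : Continuous fun σ => partialDeriv i v (onPlane i σ y) :=
    (continuous_partialDeriv hv i).comp (continuous_onPlane.comp (.prodMk_left y))
  have hFT : ∫ σ in s..c, partialDeriv i v (onPlane i σ y) =
      v (onPlane i c y) - v (onPlane i s y) :=
    intervalIntegral.integral_eq_sub_of_hasDerivAt (fun σ _ => hasDerivAt_onPlane hv σ y)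
      (hcont.intervalIntegrable _ _)
  have hmem : MemLp (fun σ => |partialDeriv i v (onPlane i σ y)|) 2
      (volume.restrict (Ioo (lo i) (hi i))) := by
    obtain ⟨C, hC⟩ := (isCompact_Icc (a := lo i) (b := hi i)).exists_bound_of_continuousOn
      hcont.abs.continuousOn
    exact MemLp.of_bound hcont.abs.aestronglyMeasurable C ((ae_restrict_iff' measurableSet_Ioo).2
      (.of_forall fun σ hσ => hC σ (Ioo_subset_Icc_self hσ)))
  have hle : |v (onPlane i c y) - v (onPlane i s y)| ≤
      ∫ σ in Ioo (lo i) (hi i), |partialDeriv i v (onPlane i σ y)| := by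
    rw [← hFT, ← integral_Ioc_eq_integral_Ioo]
    refine (intervalIntegral.norm_integral_le_integral_norm_uIoc).trans
      (setIntegral_mono_set ?_ (.of_forall fun σ => norm_nonneg (_ : ℝ)) (LE.le.eventuallyLE ?_))
    · exact (hcont.norm.integrableOn_Icc).mono_set Ioc_subset_Icc_self
    · exact Ioc_subset_Ioc (le_min hs.1 hc.1) (max_le hs.2 hc.2)
  have hcs := sq_integral_le hmem
  rw [measureReal_restrict_apply_univ, Real.volume_real_Ioo_of_le hlt] at hcs
  simp only [sq_abs] at hcs
  rw [← sq_abs]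
  exact (by gcongr : _ ≤ _).trans hcs

/-- A quantitative trace estimate. -/
theorem trace_estimate {c : ℝ} (hlt : lo i < hi i) (hc : c ∈ Icc (lo i) (hi i))
    {v u : (Fin (n + 1) → ℝ) → ℝ} {g : (Fin n → ℝ) → ℝ} (hv : ContDiff ℝ 1 v)
    (hu : MemLp u 2 (volume.restrict (openBox lo hi)))
    (hg : MemLp g 2 (volume.restrict (face lo hi i))) :
    ∫ y in face lo hi i, (v (onPlane i c y) - g y) ^ 2 ≤
      3 * ((hi i - lo i) * (∫ z in openBox lo hi, partialDeriv i v z ^ 2) +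
        (hi i - lo i)⁻¹ * (∫ z in openBox lo hi, (v z - u z) ^ 2) +
        (hi i - lo i)⁻¹ * ∫ z in openBox lo hi, (u z - g (i.removeNth z)) ^ 2) := by
  set L := hi i - lo i with hL
  have hL0 : 0 < L := sub_pos.2 hlt
  have hvc : Continuous fun y => v (onPlane i c y) :=
    hv.continuous.comp (continuous_onPlane.comp (.prodMk_right c))
  have hvm : MemLp (fun y => v (onPlane i c y)) 2 (volume.restrict (face lo hi i)) :=
    memLp_of_continuous hvc 2
  have hd : Integrable (fun z => partialDeriv i v z ^ 2) (volume.restrict (openBox lo hi)) :=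
    (memLp_of_continuous (continuous_partialDeriv hv i) 2).integrable_sq
  have h1 := integrable_fiberIntegral (i := i) hd
  have h1' : Integrable (fun z => L * fiberIntegral lo hi i (fun z => partialDeriv i v z ^ 2)
      (i.removeNth z)) (volume.restrict (openBox lo hi)) :=
    (memLp_one_iff_integrable.1 (memLp_removeNth (memLp_one_iff_integrable.2 h1))).const_mul L
  have h2 : Integrable (fun z => (v z - u z) ^ 2) (volume.restrict (openBox lo hi)) :=
    ((memLp_of_continuous hv.continuous 2).sub hu).integrable_sq
  have h3 : Integrable (fun z => (u z - g (i.removeNth z)) ^ 2) (volume.restrict (openBox lo hi)) :=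
    (hu.sub (memLp_removeNth hg)).integrable_sq
  have h12 : Integrable (fun z => L * fiberIntegral lo hi i (fun z => partialDeriv i v z ^ 2)
      (i.removeNth z) + (v z - u z) ^ 2) (volume.restrict (openBox lo hi)) := h1'.add h2
  have h0 : MemLp (fun y => v (onPlane i c y) - g y) 2 (volume.restrict (face lo hi i)) :=
    hvm.sub hg
  have h0' := (memLp_removeNth (lo := lo) (hi := hi) h0).integrable_sq
  -- On each fiber `v(c) - g` is split as `(v(c) - v(z)) + (v(z) - u(z)) + (u(z) - g)`. Integrating
  -- over the box instead of the face costs a factor `L` on the left.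
  have key : ∫ z in openBox lo hi, (v (onPlane i c (i.removeNth z)) - g (i.removeNth z)) ^ 2 ≤
      ∫ z in openBox lo hi, 3 * (L * fiberIntegral lo hi i (fun z => partialDeriv i v z ^ 2)
        (i.removeNth z) + (v z - u z) ^ 2 + (u z - g (i.removeNth z)) ^ 2) := by
    refine setIntegral_mono_on h0' (((h1'.add h2).add h3).const_mul 3) measurableSet_openBox
      fun z hz => ?_
    have hzi := mem_openBox.1 hz i
    have h := sq_sub_onPlane_le hv hc (Ioo_subset_Icc_self hzi) (i.removeNth z)
    rw [onPlane_removeNth] at h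
    have e : ∀ a b d : ℝ, (a + b + d) ^ 2 ≤ 3 * (a ^ 2 + b ^ 2 + d ^ 2) := fun a b d => by
      nlinarith [sq_nonneg (a - b), sq_nonneg (b - d), sq_nonneg (a - d)]
    have e' := e (v (onPlane i c (i.removeNth z)) - v z) (v z - u z) (u z - g (i.removeNth z))
    rw [sub_add_sub_cancel, sub_add_sub_cancel] at e'
    linarith
  rw [integral_removeNth (g := fun y => (v (onPlane i c y) - g y) ^ 2) hlt.le h0.integrable_sq,
    integral_const_mul, integral_add h12 h3, integral_add h1' h2, integral_const_mul,
    integral_removeNth hlt.le h1] at key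
  have hs : ∫ y in face lo hi i, fiberIntegral lo hi i (fun z => partialDeriv i v z ^ 2) y =
      ∫ z in openBox lo hi, partialDeriv i v z ^ 2 := (integral_slice hd).symm
  rw [hs, ← hL] at key
  rw [← mul_le_mul_iff_right₀ hL0]
  refine key.trans (le_of_eq ?_)
  field_simp

theorem face_update_lo (c : ℝ) : face (Function.update lo i c) hi i = face lo hi i := by
  simp [face]

theorem face_update_hi (c : ℝ) : face lo (Function.update hi i c) i = face lo hi i := by
  simp [face]

/-- The trace estimate on a thin slab at the face. -/
theorem trace_estimate_slab {c h : ℝ} (hh : 0 < h) (hh' : h ≤ hi i - lo i)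
    (hc : c = lo i ∨ c = hi i)
    {v u : (Fin (n + 1) → ℝ) → ℝ} {g : (Fin n → ℝ) → ℝ} (hv : ContDiff ℝ 1 v)
    (hu : MemLp u 2 (volume.restrict (openBox lo hi)))
    (hg : MemLp g 2 (volume.restrict (face lo hi i))) :
    ∫ y in face lo hi i, (v (onPlane i c y) - g y) ^ 2 ≤
      3 * (h * (∫ z in openBox lo hi, partialDeriv i v z ^ 2) +
        h⁻¹ * (∫ z in openBox lo hi, (v z - u z) ^ 2) +
        h⁻¹ * ∫ z in openBox lo hi ∩ {z | |z i - c| < h}, (u z - g (i.removeNth z)) ^ 2) := by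
  -- The slab is itself a box with the same face, obtained by moving the opposite face to distance
  -- `h`.
  obtain ⟨lo', hi', hface, hlen, hcI, hslab⟩ : ∃ lo' hi' : Fin (n + 1) → ℝ,
      face lo' hi' i = face lo hi i ∧ hi' i - lo' i = h ∧ c ∈ Icc (lo' i) (hi' i) ∧
      openBox lo' hi' = openBox lo hi ∩ {z | |z i - c| < h} := by
    rcases hc with rfl | rfl
    · refine ⟨lo, Function.update hi i (lo i + h), face_update_hi _, by simp, by simp [hh.le], ?_⟩
      ext z
      simp only [mem_inter_iff, mem_openBox, mem_ofPred_eq, Fin.forall_iff_succAbove i,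
        Function.update_self, Function.update_of_ne (Fin.succAbove_ne i _), mem_Ioo, abs_lt]
      constructor
      · rintro ⟨⟨h1, h2⟩, h3⟩
        exact ⟨⟨⟨h1, by linarith⟩, h3⟩, by linarith, by linarith⟩
      · rintro ⟨⟨⟨h1, h2⟩, h3⟩, h4, h5⟩
        exact ⟨⟨h1, by linarith⟩, h3⟩
    · refine ⟨Function.update lo i (hi i - h), hi, face_update_lo _, by simp, by simp [hh.le], ?_⟩
      ext z
      simp only [mem_inter_iff, mem_openBox, mem_ofPred_eq, Fin.forall_iff_succAbove i,
        Function.update_self, Function.update_of_ne (Fin.succAbove_ne i _), mem_Ioo, abs_lt]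
      constructor
      · rintro ⟨⟨h1, h2⟩, h3⟩
        exact ⟨⟨⟨by linarith, h2⟩, h3⟩, by linarith, by linarith⟩
      · rintro ⟨⟨⟨h1, h2⟩, h3⟩, h4, h5⟩
        exact ⟨⟨by linarith, h2⟩, h3⟩
  have hsub : openBox lo' hi' ⊆ openBox lo hi := hslab ▸ inter_subset_left
  have hest := trace_estimate (lo := lo') (hi := hi') (g := g) (by linarith) hcI hv
    (hu.mono_measure (Measure.restrict_mono hsub le_rfl)) (by rwa [hface])
  rw [hface, hlen, ← hslab.symm] at hest
  refine hest.trans ?_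
  rw [← hslab]
  gcongr 3 * (h * ?_ + h⁻¹ * ?_ + _)
  · exact setIntegral_mono_set (memLp_of_continuous (continuous_partialDeriv hv i) 2).integrable_sq
      (.of_forall fun z => sq_nonneg _) (LE.le.eventuallyLE hsub)
  · exact setIntegral_mono_set ((memLp_of_continuous hv.continuous 2).sub hu).integrable_sq
      (.of_forall fun z => sq_nonneg _) (LE.le.eventuallyLE hsub)

theorem exists_integral_sq_bound {α : Type*} [MeasurableSpace α] {μ : Measure α} {w : α → ℝ}
    {f : ℕ → α → ℝ} (hw : MemLp w 2 μ) (h : L2Null μ fun k x => f k x - w x) :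
    ∃ M, 0 < M ∧ ∀ᶠ k in atTop, ∫ x, f k x ^ 2 ∂μ ≤ M := by
  have hw0 : 0 ≤ ∫ x, w x ^ 2 ∂μ := by positivity
  refine ⟨2 + 2 * ∫ x, w x ^ 2 ∂μ, by positivity, ?_⟩
  filter_upwards [h.tendsto.eventually (gt_mem_nhds one_pos)] with k hk
  have h1 := (h.memLp k).integrable_sq.const_mul 2
  have h2 := hw.integrable_sq.const_mul 2
  have hf : MemLp (f k) 2 μ :=
    (memLp_congr_ae (.of_forall fun x => by simp)).1 ((h.memLp k).add hw)
  calc ∫ x, f k x ^ 2 ∂μ ≤ ∫ x, (2 * (f k x - w x) ^ 2 + 2 * w x ^ 2) ∂μ :=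
        integral_mono hf.integrable_sq (h1.add h2) fun x => by
          nlinarith [sq_nonneg (f k x - 2 * w x)]
    _ ≤ _ := by
        rw [integral_add h1 h2, integral_const_mul, integral_const_mul]
        linarith

/-- Convergence in `H¹` implies convergence of the traces in `L²`. -/
theorem HasFaceTrace.l2Null {c : ℝ} (hlt : lo i < hi i) (hc : c = lo i ∨ c = hi i)
    {u w : (Fin (n + 1) → ℝ) → ℝ} {g : (Fin n → ℝ) → ℝ} (htr : HasFaceTrace lo hi i c u g)
    (hu : MemLp u 2 (volume.restrict (openBox lo hi)))
    (hw : MemLp w 2 (volume.restrict (openBox lo hi)))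
    {v : ℕ → (Fin (n + 1) → ℝ) → ℝ} (hv : ∀ k, ContDiff ℝ 1 (v k))
    (h₀ : L2Null (volume.restrict (openBox lo hi)) fun k z => v k z - u z)
    (h₁ : L2Null (volume.restrict (openBox lo hi)) fun k z => partialDeriv i (v k) z - w z) :
    L2Null (volume.restrict (face lo hi i)) fun k y => v k (onPlane i c y) - g y := by
  refine ⟨fun k => ?_, ?_⟩
  · exact (memLp_of_continuous ((hv k).continuous.comp
      (continuous_onPlane.comp (.prodMk_right c))) 2).sub htr.memLp
  · obtain ⟨M, hM, hbM⟩ := exists_integral_sq_bound hw h₁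
    rw [Metric.tendsto_nhds]
    intro η hη
    -- The order of choices matters. The thickness `h` is fixed first, making the derivative term
    -- and the trace term less than `η / 9`; only then is `k` taken large enough to beat the factor
    -- `h⁻¹`.
    obtain ⟨h, ⟨hh1, hh2, hh3⟩, hh0⟩ : ∃ h : ℝ, (h < hi i - lo i ∧ h < η / (9 * M) ∧
        h⁻¹ * ∫ z in openBox lo hi ∩ {z | |z i - c| < h}, |u z - g (i.removeNth z)| ^ 2 < η / 9) ∧
        0 < h := by
      have e1 : ∀ a > 0, ∀ᶠ h : ℝ in 𝓝[>] 0, h < a := fun a ha =>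
        nhdsWithin_le_nhds (gt_mem_nhds ha)
      exact (((e1 _ (sub_pos.2 hlt)).and ((e1 (η / (9 * M)) (by positivity)).and
        (htr.tendsto.eventually (gt_mem_nhds (by positivity : 0 < η / 9))))).and
        eventually_mem_nhdsWithin).exists
    simp only [sq_abs] at hh3
    filter_upwards [hbM, h₀.tendsto.eventually (gt_mem_nhds (by positivity : 0 < h * (η / 9)))]
      with k hk1 hk2
    have hest := trace_estimate_slab hh0 hh1.le hc (hv k) hu htr.memLp
    rw [Real.dist_eq, sub_zero, abs_of_nonneg (by positivity)]
    refine hest.trans_lt ?_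
    have b1 : h * (∫ z in openBox lo hi, partialDeriv i (v k) z ^ 2) < η / 9 := by
      calc _ ≤ h * M := by gcongr
        _ < η / (9 * M) * M := by gcongr
        _ = η / 9 := by field_simp
    have b2 : h⁻¹ * (∫ z in openBox lo hi, (v k z - u z) ^ 2) < η / 9 := by
      rw [inv_mul_lt_iff₀ hh0]; exact hk2
    linarith

end Trace

/-! ### Approximation of Sobolev functions by networks -/

section Sobolev

variable {n : ℕ} {lo hi : Fin n → ℝ}

/-- The fundamental lemma of the calculus of variations. It transfers square integrability from the
derivatives supplied by `MemH` to the chosen version `weakPartial`. -/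
theorem HasWeakPartial.ae_eq {i : Fin n} {u v v' : (Fin n → ℝ) → ℝ}
    (h : HasWeakPartial (openBox lo hi) i u v) (h' : HasWeakPartial (openBox lo hi) i u v') :
    v =ᵐ[volume.restrict (openBox lo hi)] v' := by
  have key : ∀ᵐ z, z ∈ openBox lo hi → v z - v' z = 0 := by
    refine isOpen_openBox.ae_eq_zero_of_integral_contDiff_smul_eq_zero
      (h.locInt_deriv.sub h'.locInt_deriv) fun g hg hgc hgs => ?_
    have hint : ∀ w, LocallyIntegrableOn w (openBox lo hi) →
        IntegrableOn (fun z => w z * g z) (openBox lo hi) := by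
      intro w hw
      have h1 : IntegrableOn (fun z => w z * g z) (tsupport g) :=
        (hw.integrableOn_compact_subset hgs hgc).mul_continuousOn hg.continuous.continuousOn hgc
      refine (h1.integrable_of_forall_notMem_eq_zero fun z hz => ?_).integrableOn
      rw [image_eq_zero_of_notMem_tsupport hz, mul_zero]
    rw [← setIntegral_eq_integral_of_forall_compl_eq_zero (s := openBox lo hi)]
    · have e := (h.integral_eq g hg hgc hgs).symm.trans (h'.integral_eq g hg hgc hgs)
      simp only [smul_eq_mul, mul_comm (g _), sub_mul]
      rw [integral_sub (hint v h.locInt_deriv) (hint v' h'.locInt_deriv)]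
      linarith
    · intro x hx
      rw [image_eq_zero_of_notMem_tsupport fun h => hx (hgs h), zero_smul]
  filter_upwards [(ae_restrict_iff' measurableSet_openBox).2 key] with z hz
  linarith

theorem MemH.memLp {U : Set (Fin n → ℝ)} {k : ℕ} {u : (Fin n → ℝ) → ℝ} (h : MemH U k u) :
    MemLp u 2 (volume.restrict U) := by
  cases k with
  | zero => exact h
  | succ k => exact h.1

theorem MemH.hasWeakPartial {U : Set (Fin n → ℝ)} {k : ℕ} {u : (Fin n → ℝ) → ℝ}
    (h : MemH U (k + 1) u) (i : Fin n) : HasWeakPartial U i u (weakPartial U i u) := by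
  obtain ⟨v, hv, -⟩ := h.2 i
  exact hasWeakPartial_weakPartial hv

theorem MemH.memLp_weakPartial {k : ℕ} {u : (Fin n → ℝ) → ℝ} (h : MemH (openBox lo hi) (k + 1) u)
    (i : Fin n) : MemLp (weakPartial (openBox lo hi) i u) 2 (volume.restrict (openBox lo hi)) := by
  obtain ⟨v, hv, hv'⟩ := h.2 i
  exact (memLp_congr_ae (hv.ae_eq (h.hasWeakPartial i))).1 hv'.memLp

/-- The `C¹` functions `v k` converge to `u` in `H¹` of the box. -/
structure H1Tendsto (lo hi : Fin n → ℝ) (v : ℕ → (Fin n → ℝ) → ℝ) (u : (Fin n → ℝ) → ℝ) :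
    Prop where
  contDiff : ∀ k, ContDiff ℝ 1 (v k)
  memLp : MemLp u 2 (volume.restrict (openBox lo hi))
  memLp_deriv : ∀ i, MemLp (weakPartial (openBox lo hi) i u) 2 (volume.restrict (openBox lo hi))
  null : L2Null (volume.restrict (openBox lo hi)) fun k z => v k z - u z
  null_deriv : ∀ i, L2Null (volume.restrict (openBox lo hi)) fun k z =>
    partialDeriv i (v k) z - weakPartial (openBox lo hi) i u z

theorem L2Null.of_continuous_of_abs_le {f : ℕ → (Fin n → ℝ) → ℝ} (hf : ∀ k, Continuous (f k))
    (h : ∀ k, ∀ z ∈ Icc lo hi, |f k z| ≤ 1 / ((k : ℝ) + 1)) :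
    L2Null (volume.restrict (openBox lo hi)) f := by
  set V := volume.real (openBox lo hi)
  refine .of_le (b := fun k => (1 / ((k : ℝ) + 1)) ^ 2 * V)
    (fun k => memLp_of_continuous (hf k) 2) ?_ fun k => ?_
  · simpa using ((tendsto_one_div_add_atTop_nhds_zero_nat (𝕜 := ℝ)).pow 2).mul_const V
  · calc ∫ z in openBox lo hi, f k z ^ 2 ≤ ∫ z in openBox lo hi, (1 / ((k : ℝ) + 1)) ^ 2 := by
          refine setIntegral_mono_on (memLp_of_continuous (hf k) 2).integrable_sq
            (integrable_const _) measurableSet_openBox fun z hz => ?_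
          rw [← sq_abs]
          gcongr
          exact h k z (openBox_subset_Icc hz)
      _ = (1 / ((k : ℝ) + 1)) ^ 2 * V := by
          rw [integral_const, smul_eq_mul, measureReal_restrict_apply_univ, mul_comm]

/-- A cosine mode is a product of functions of one coordinate each. The hypothesis `hmode` asks that
each factor be a `C¹` function of a single network input. -/
theorem cosAlg_le_closure_netSpan {d : ℕ} {Φ : (Fin n → ℝ) → Fin d → ℝ} (hΦ : ContDiff ℝ 1 Φ)
    (hmode : ∀ j k, ∃ (F : ℝ → ℝ) (i : Fin d), ContDiff ℝ 1 F ∧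
      ∀ z, cosMode₁ (lo j) (hi j) k (z j) = F (Φ z i))
    {p : (Fin n → ℝ) → ℝ} (hp : p ∈ cosAlg lo hi) : p ∈ c1Closure (Icc lo hi) (netSpan Φ) := by
  refine adjoin_le_closure_netSpan isCompact_Icc hΦ ?_
  rw [mem_cosAlg] at hp
  refine (Submodule.span_le.2 ?_) hp
  rintro _ ⟨k, rfl⟩
  have e : cosMode lo hi k = ∏ j, fun z => cosMode₁ (lo j) (hi j) (k j) (z j) := by
    ext z; simp [cosMode, tensor]
  rw [e]
  refine Subalgebra.prod_mem _ fun j _ => Algebra.subset_adjoin ?_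
  obtain ⟨F, i, hF, h⟩ := hmode j (k j)
  exact ⟨F, i, hF, funext h⟩

/-- Every function in `H²` of a box is an `H¹` limit of networks. -/
theorem exists_nets_H1Tendsto {d : ℕ} {Φ : (Fin n → ℝ) → Fin d → ℝ} (hlt : ∀ j, lo j < hi j)
    (hΦ : ContDiff ℝ 1 Φ)
    (hmode : ∀ j k, ∃ (F : ℝ → ℝ) (i : Fin d), ContDiff ℝ 1 F ∧
      ∀ z, cosMode₁ (lo j) (hi j) k (z j) = F (Φ z i))
    {u : (Fin n → ℝ) → ℝ} (hu : MemH (openBox lo hi) 2 u) :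
    ∃ (m : ℕ → ℕ) (A : ∀ k, TanhNet d (m k)), H1Tendsto lo hi (fun k z => (A k).eval (Φ z)) u := by
  have hδ : ∀ k : ℕ, 0 < 1 / ((k : ℝ) + 1) := fun k => by positivity
  -- The function is approximated by a cosine polynomial in `H¹`, and that polynomial by a network
  -- in `C¹` on the closed box.
  choose p hpA hp hp' using fun k => exists_cosAlg_H1_close hlt hu.memLp
    (fun i => hu.memLp_weakPartial i) (fun i => hu.hasWeakPartial i) (hδ k)
  have hpc : ∀ k, ContDiff ℝ 1 (p k) := fun k => contDiff_of_mem_cosAlg (hpA k)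
  choose f hf hfc hfp using fun k => (cosAlg_le_closure_netSpan hΦ hmode (hpA k)).2 _ (hδ k)
  choose m A hA using hf
  have hlim := tendsto_one_div_add_atTop_nhds_zero_nat (𝕜 := ℝ)
  have hfe : (fun k z => (A k).eval (Φ z)) = f := funext fun k => (hA k).symm
  refine ⟨m, A, ?_⟩
  rw [hfe]
  refine ⟨hfc, hu.memLp, fun i => hu.memLp_weakPartial i, ?_, fun i => ?_⟩
  · have h1 : L2Null (volume.restrict (openBox lo hi)) fun k z => p k z - u z :=
      .of_le (fun k => (memLp_of_continuous (hpc k).continuous 2).sub hu.memLp) hlim hp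
    have h2 : L2Null (volume.restrict (openBox lo hi)) fun k z => p k z - f k z :=
      .of_continuous_of_abs_le (fun k => (hpc k).continuous.sub (hfc k).continuous)
        fun k z hz => (hfp k z hz).1
    simpa using h1.sub h2
  · have h1 : L2Null (volume.restrict (openBox lo hi)) fun k z =>
        partialDeriv i (p k) z - weakPartial (openBox lo hi) i u z :=
      .of_le (fun k => (memLp_of_continuous (continuous_partialDeriv (hpc k) i) 2).sub
        (hu.memLp_weakPartial i)) hlim fun k => hp' k i
    have h2 : L2Null (volume.restrict (openBox lo hi)) fun k z =>
        partialDeriv i (p k) z - partialDeriv i (f k) z :=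
      .of_continuous_of_abs_le
        (fun k => (continuous_partialDeriv (hpc k) i).sub (continuous_partialDeriv (hfc k) i))
        fun k z hz => (hfp k z hz).2 i
    simpa using h1.sub h2

end Sobolev

theorem H1Tendsto.trace {n : ℕ} {lo hi : Fin (n + 1) → ℝ} {v : ℕ → (Fin (n + 1) → ℝ) → ℝ}
    {u : (Fin (n + 1) → ℝ) → ℝ} (h : H1Tendsto lo hi v u) {i : Fin (n + 1)} {c : ℝ}
    {g : (Fin n → ℝ) → ℝ} (hlt : lo i < hi i) (hc : c = lo i ∨ c = hi i)
    (htr : HasFaceTrace lo hi i c u g) :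
    L2Null (volume.restrict (face lo hi i)) fun k y => v k (onPlane i c y) - g y :=
  htr.l2Null hlt hc h.memLp (h.memLp_deriv i) h.contDiff h.null (h.null_deriv i)

/-! ### The domain -/

theorem contDiff_withVelocity {m : WithTop ℕ∞} : ContDiff ℝ m withVelocity := by
  refine contDiff_pi.2 fun i => ?_
  fin_cases i
  · exact contDiff_apply ℝ ℝ 0
  · exact contDiff_apply ℝ ℝ 1
  · exact contDiff_apply ℝ ℝ 2
  · exact Real.contDiff_cos.comp (contDiff_apply ℝ ℝ 3)
  · exact Real.contDiff_sin.comp (contDiff_apply ℝ ℝ 3)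

namespace Domain

variable (Q : Domain)

theorem lo_lt_hi (j : Fin 3) : Q.lo j < Q.hi j := by
  fin_cases j
  · exact Q.T_pos
  · exact Q.x_lt
  · exact Q.y_lt

theorem loV_lt_hiV (j : Fin 4) : Q.loV j < Q.hiV j := by
  fin_cases j
  · exact Q.T_pos
  · exact Q.x_lt
  · exact Q.y_lt
  · exact Real.pi_div_two_pos

theorem face_loV_hiV : face Q.loV Q.hiV 3 = Q.macro₃ := by
  unfold face macro₃
  congr 1 <;> ext j <;> fin_cases j <;> rfl

/-- The networks see `(ξ, η)` and not `θ`. As `θ` ranges over an interval of length `π/2`, the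
angular modes are `cos 2kθ = T₂ₖ(cos θ)`, polynomials in the input `ξ` alone. -/
theorem exists_feature (j : Fin 4) (k : ℤ) : ∃ (F : ℝ → ℝ) (i : Fin 5), ContDiff ℝ 1 F ∧
    ∀ z, cosMode₁ (Q.loV j) (Q.hiV j) k (z j) = F (withVelocity z i) := by
  fin_cases j
  · exact ⟨_, 0, contDiff_cosMode₁, fun z => rfl⟩
  · exact ⟨_, 1, contDiff_cosMode₁, fun z => rfl⟩
  · exact ⟨_, 2, contDiff_cosMode₁, fun z => rfl⟩
  · refine ⟨fun x => (Polynomial.Chebyshev.T ℝ (2 * k)).eval x, 3,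
      by simpa using (Polynomial.Chebyshev.T ℝ (2 * k)).contDiff_aeval (𝕜 := ℝ) 1, fun z => ?_⟩
    change Real.cos (k * (Real.pi / (Real.pi / 2 - 0)) * (z 3 - 0)) =
      (Polynomial.Chebyshev.T ℝ (2 * k)).eval (Real.cos (z 3))
    rw [Polynomial.Chebyshev.T_real_cos]
    congr 1
    have := Real.pi_ne_zero
    push_cast
    field_simp
    ring

end Domain

theorem velAvg_eq (Q : Domain) (g : (Fin 4 → ℝ) → ℝ) (p : Fin 3 → ℝ) :
    velAvg g p = 2 / Real.pi * fiberIntegral Q.loV Q.hiV 3 g p := by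
  unfold velAvg fiberIntegral
  have e : ∀ θ, Fin.snoc (α := fun _ => ℝ) p θ = onPlane 3 θ p := fun θ =>
    (Fin.insertNth_last' θ p).symm
  simp only [e]
  rfl

theorem init_eq_removeNth (z : Fin 4 → ℝ) : Fin.init z = (3 : Fin 4).removeNth z := by
  ext j; fin_cases j <;> rfl

/-! ### Convergence of the residuals -/

/-- All components of the fields `s k` converge to those of `sol` in `H¹`. -/
structure FieldsTendsto (Q : Domain) (s : ℕ → Fields 3) (sol : Fields 3) : Prop where
  ρ : H1Tendsto Q.lo Q.hi (fun k => (s k).ρ) sol.ρ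
  φ : H1Tendsto Q.loV Q.hiV (fun k => (s k).φ) sol.φ
  j₁ : H1Tendsto Q.loV Q.hiV (fun k => (s k).j₁) sol.j₁
  j₂ : H1Tendsto Q.loV Q.hiV (fun k => (s k).j₂) sol.j₂
  w : H1Tendsto Q.loV Q.hiV (fun k => (s k).w) sol.w

section Residuals

variable {Q : Domain} {s : ℕ → Fields 3} {sol : Fields 3}

theorem L2Null.cos_mul {f : ℕ → (Fin 4 → ℝ) → ℝ} (hf : L2Null (volume.restrict Q.kinetic₄) f) :
    L2Null (volume.restrict Q.kinetic₄) fun k z => Real.cos (z 3) * f k z :=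
  hf.mul_of_abs_le_one (Real.continuous_cos.comp (continuous_apply 3)).aestronglyMeasurable
    fun _ => Real.abs_cos_le_one _

theorem L2Null.sin_mul {f : ℕ → (Fin 4 → ℝ) → ℝ} (hf : L2Null (volume.restrict Q.kinetic₄) f) :
    L2Null (volume.restrict Q.kinetic₄) fun k z => Real.sin (z 3) * f k z :=
  hf.mul_of_abs_le_one (Real.continuous_sin.comp (continuous_apply 3)).aestronglyMeasurable
    fun _ => Real.abs_sin_le_one _

theorem L2Null.comp_init {f : ℕ → (Fin 3 → ℝ) → ℝ} (hf : L2Null (volume.restrict Q.macro₃) f) :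
    L2Null (volume.restrict Q.kinetic₄) fun k z => f k (Fin.init z) := by
  simp only [init_eq_removeNth]
  rw [← Q.face_loV_hiV] at hf
  exact hf.removeNth (Q.loV_lt_hiV 3).le

/-- Additivity of the average needs integrability on fibers, which holds only almost everywhere; the
identity is therefore used up to null sets. -/
theorem L2Null.velAvg_sub {f : ℕ → (Fin 4 → ℝ) → ℝ} {g : (Fin 4 → ℝ) → ℝ}
    (hg : MemLp g 2 (volume.restrict Q.kinetic₄))
    (h : L2Null (volume.restrict Q.kinetic₄) fun k z => f k z - g z) :
    L2Null (volume.restrict Q.macro₃) fun k p => velAvg (f k) p - velAvg g p := by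
  rw [← Q.face_loV_hiV]
  refine ((h.fiberIntegral (Q.loV_lt_hiV 3).le).const_mul (2 / Real.pi)).congr fun k => ?_
  have hf : MemLp (f k) 2 (volume.restrict Q.kinetic₄) :=
    (memLp_congr_ae (.of_forall fun x => by simp)).1 ((h.memLp k).add hg)
  filter_upwards [fiberIntegral_sub_ae (i := 3) hf hg] with p hp
  rw [hp, velAvg_eq Q, velAvg_eq Q, mul_sub]

theorem FieldsTendsto.flux (h : FieldsTendsto Q s sol) : L2Null (volume.restrict Q.kinetic₄)
    fun k z => flux partialDeriv (s k) z - flux (weakPartial Q.kinetic₄) sol z := by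
  refine (((h.j₁.null_deriv 1).add (h.j₂.null_deriv 1)).cos_mul.add
    ((h.j₂.null_deriv 2).sub (h.j₁.null_deriv 2)).sin_mul).congr
      fun k => .of_forall fun z => ?_
  simp only [ParityAPNN.flux, Domain.kinetic₄]
  ring

theorem FieldsTendsto.memLp_flux (h : FieldsTendsto Q s sol) :
    MemLp (ParityAPNN.flux (weakPartial Q.kinetic₄) sol) 2 (volume.restrict Q.kinetic₄) := by
  have hc : ∀ {c : (Fin 4 → ℝ) → ℝ} {f : (Fin 4 → ℝ) → ℝ}, Continuous c → (∀ z, |c z| ≤ 1) →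
      MemLp f 2 (volume.restrict Q.kinetic₄) →
      MemLp (fun z => c z * f z) 2 (volume.restrict Q.kinetic₄) := fun hc hc1 hf =>
    hf.mono (hc.aestronglyMeasurable.mul hf.aestronglyMeasurable) (.of_forall fun z => by
      rw [norm_mul]; exact mul_le_of_le_one_left (norm_nonneg _) (hc1 z))
  exact (hc (by fun_prop) (fun z => Real.abs_cos_le_one (z 3))
    ((h.j₁.memLp_deriv 1).add (h.j₂.memLp_deriv 1))).add
    (hc (by fun_prop) (fun z => Real.abs_sin_le_one (z 3))
    ((h.j₂.memLp_deriv 2).sub (h.j₁.memLp_deriv 2)))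

theorem FieldsTendsto.velAvg_flux (h : FieldsTendsto Q s sol) :
    L2Null (volume.restrict Q.macro₃) fun k p =>
      velAvg (ParityAPNN.flux partialDeriv (s k)) p -
        velAvg (ParityAPNN.flux (weakPartial Q.kinetic₄) sol) p :=
  h.flux.velAvg_sub h.memLp_flux

variable {ε : ℝ}

/-- The residual of the solution vanishes almost everywhere, so the residual of the networks equals
a linear expression in the errors. The other four residuals are treated in the same way. -/
theorem FieldsTendsto.residual₁ (h : FieldsTendsto Q s sol) (hsol : IsParitySolution Q ε sol) :
    L2Null (volume.restrict Q.macro₃) fun k => residual₁ partialDeriv partialDeriv (s k) := by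
  refine (((h.ρ.null_deriv 0).const_mul 2).add h.velAvg_flux).congr fun k => ?_
  filter_upwards [hsol.eq₁] with p hp
  simp only [ParityAPNN.residual₁, Domain.macro₃] at hp ⊢
  linarith

theorem FieldsTendsto.residual₂ (h : FieldsTendsto Q s sol) (hsol : IsParitySolution Q ε sol) :
    L2Null (volume.restrict Q.kinetic₄) fun k => residual₂ ε partialDeriv (s k) := by
  refine (((((h.w.null_deriv 0).const_mul (2 * ε ^ 2)).add h.flux).sub
    h.velAvg_flux.comp_init).add (h.w.null.const_mul 2)).congr fun k => ?_
  filter_upwards [hsol.eq₂] with z hz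
  simp only [ParityAPNN.residual₂, Domain.kinetic₄] at hz ⊢
  linarith

theorem FieldsTendsto.residual₃ (hε : 0 < ε) (h : FieldsTendsto Q s sol)
    (hsol : IsParitySolution Q ε sol) :
    L2Null (volume.restrict Q.kinetic₄) fun k => residual₃ ε partialDeriv (s k) := by
  refine ((((h.φ.null_deriv 0).add ((h.j₂.null_deriv 1).sub (h.j₁.null_deriv 1)).cos_mul).add
    ((h.j₁.null_deriv 2).add (h.j₂.null_deriv 2)).sin_mul).add
      (h.φ.null.const_mul (1 / ε ^ 2))).congr fun k => ?_
  filter_upwards [hsol.eq₃] with z hz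
  -- The equation for the solution carries a factor `ε²`, whereas the loss does not; the factor is
  -- cancelled here.
  have hz' := (mul_eq_zero.1 hz).resolve_left (by positivity)
  simp only [ParityAPNN.residual₃, Domain.kinetic₄] at hz' ⊢
  linarith

theorem FieldsTendsto.residual₄ (h : FieldsTendsto Q s sol) (hsol : IsParitySolution Q ε sol) :
    L2Null (volume.restrict Q.kinetic₄) fun k =>
      residual₄ ε partialDeriv partialDeriv (s k) := by
  have hρ : L2Null (volume.restrict Q.macro₃) _ := h.ρ.null_deriv 1
  refine ((((((h.j₁.null_deriv 0).add (h.j₂.null_deriv 0)).const_mul (ε ^ 2)).add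
    (h.j₁.null.add h.j₂.null)).add
    ((hρ.comp_init.add ((h.w.null_deriv 1).const_mul (ε ^ 2))).cos_mul.const_mul 2)).add
      (h.φ.null_deriv 2).sin_mul).congr fun k => ?_
  filter_upwards [hsol.eq₄] with z hz
  simp only [ParityAPNN.residual₄, Domain.kinetic₄, Domain.macro₃] at hz ⊢
  linarith

theorem FieldsTendsto.residual₅ (h : FieldsTendsto Q s sol) (hsol : IsParitySolution Q ε sol) :
    L2Null (volume.restrict Q.kinetic₄) fun k =>
      residual₅ ε partialDeriv partialDeriv (s k) := by
  have hρ : L2Null (volume.restrict Q.macro₃) _ := h.ρ.null_deriv 2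
  refine ((((((h.j₂.null_deriv 0).sub (h.j₁.null_deriv 0)).const_mul (ε ^ 2)).add
    (h.j₂.null.sub h.j₁.null)).add (h.φ.null_deriv 1).cos_mul).add
    ((hρ.comp_init.add ((h.w.null_deriv 2).const_mul (ε ^ 2))).sin_mul.const_mul 2)).congr
      fun k => ?_
  filter_upwards [hsol.eq₅] with z hz
  simp only [ParityAPNN.residual₅, Domain.kinetic₄, Domain.macro₃] at hz ⊢
  linarith

/-! ### Convergence of the loss -/

theorem FieldsTendsto.lossResidual (hε : 0 < ε) (h : FieldsTendsto Q s sol)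
    (hsol : IsParitySolution Q ε sol) :
    Tendsto (fun k => lossResidual Q ε (s k)) atTop (𝓝 0) := by
  simp only [ParityAPNN.lossResidual, sq_abs]
  simpa using ((h.residual₁ hsol).tendsto.const_mul (1 / volume.real Q.macro₃)).add
    (((((h.residual₂ hsol).tendsto.add (h.residual₃ hε hsol).tendsto).add
      (h.residual₄ hsol).tendsto).add (h.residual₅ hsol).tendsto).const_mul
        (1 / volume.real Q.kinetic₄))

/-- The shape serves both data terms: weights `ε⁴, ε²` for the initial loss, `1, 1` for the boundary
loss. -/
theorem L2Null.tendsto_weighted_sum {α : Type*} [MeasurableSpace α] {μ : Measure α}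
    {f₁ f₂ f₃ f₄ : ℕ → α → ℝ} (h₁ : L2Null μ f₁) (h₂ : L2Null μ f₂) (h₃ : L2Null μ f₃)
    (h₄ : L2Null μ f₄) (a b : ℝ) :
    Tendsto (fun k => ∫ x, (a * f₁ k x ^ 2 + f₂ k x ^ 2 + b * (f₃ k x ^ 2 + f₄ k x ^ 2)) ∂μ)
      atTop (𝓝 0) := by
  have e : ∀ k, ∫ x, (a * f₁ k x ^ 2 + f₂ k x ^ 2 + b * (f₃ k x ^ 2 + f₄ k x ^ 2)) ∂μ =
      a * (∫ x, f₁ k x ^ 2 ∂μ) + (∫ x, f₂ k x ^ 2 ∂μ) +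
        b * ((∫ x, f₃ k x ^ 2 ∂μ) + ∫ x, f₄ k x ^ 2 ∂μ) := by
    intro k
    have i₁ := (h₁.memLp k).integrable_sq.const_mul a
    have i₂ := (h₂.memLp k).integrable_sq
    have i₃ := (h₃.memLp k).integrable_sq
    have i₄ := (h₄.memLp k).integrable_sq
    have i₁₂ : Integrable (fun x => a * f₁ k x ^ 2 + f₂ k x ^ 2) μ := i₁.add i₂
    have i₃₄ : Integrable (fun x => f₃ k x ^ 2 + f₄ k x ^ 2) μ := i₃.add i₄
    rw [integral_add i₁₂ (i₃₄.const_mul b), integral_add i₁ i₂, integral_const_mul,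
      integral_const_mul, integral_add i₃ i₄]
  simp only [e]
  simpa using ((h₁.tendsto.const_mul a).add h₂.tendsto).add
    ((h₃.tendsto.add h₄.tendsto).const_mul b)

theorem FieldsTendsto.lossInitial (h : FieldsTendsto Q s sol) {ic : Fields 2}
    (hic : HasInitialData Q sol ic) (lam₁ lam₂ : ℝ) :
    Tendsto (fun k => lossInitial Q ε lam₁ lam₂ ic (s k)) atTop (𝓝 0) := by
  have hρ := h.ρ.trace (c := 0) (Q.lo_lt_hi 0) (Or.inl rfl) hic.ρ
  have hφ := h.φ.trace (c := 0) (Q.loV_lt_hiV 0) (Or.inl rfl) hic.φ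
  have hj₁ := h.j₁.trace (c := 0) (Q.loV_lt_hiV 0) (Or.inl rfl) hic.j₁
  have hj₂ := h.j₂.trace (c := 0) (Q.loV_lt_hiV 0) (Or.inl rfl) hic.j₂
  have hw := h.w.trace (c := 0) (Q.loV_lt_hiV 0) (Or.inl rfl) hic.w
  have h2 := hw.tendsto_weighted_sum hφ (hj₁.add hj₂) (hj₂.sub hj₁) (ε ^ 4) (ε ^ 2)
  have := (hρ.tendsto.const_mul (lam₁ / volume.real (face Q.lo Q.hi 0))).add
    (h2.const_mul (lam₂ / volume.real (face Q.loV Q.hiV 0)))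
  simp only [mul_zero, add_zero] at this
  simpa only [ParityAPNN.lossInitial, sq_abs, add_sub_add_comm, sub_sub_sub_comm] using this

theorem FieldsTendsto.lossBoundary (h : FieldsTendsto Q s sol) {bc : Fields 3}
    (hbc : HasBoundaryData Q sol bc) (lam₃ lam₄ : ℝ) :
    Tendsto (fun k => lossBoundary Q lam₃ lam₄ bc (s k)) atTop (𝓝 0) := by
  have hρ : ∀ i : Fin 3, i = 1 ∨ i = 2 → ∀ c, c = Q.lo i ∨ c = Q.hi i →
      Tendsto (fun k => faceIntegral Q.lo Q.hi i c fun p => |(s k).ρ p - bc.ρ p| ^ 2)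
        atTop (𝓝 0) := by
    intro i hi c hc
    have htr : HasFaceTrace Q.lo Q.hi i c sol.ρ fun y => bc.ρ (onPlane i c y) := by
      rcases hc with rfl | rfl
      exacts [(hbc.ρ i hi).1, (hbc.ρ i hi).2]
    simpa only [faceIntegral, sq_abs] using (h.ρ.trace (Q.lo_lt_hi i) hc htr).tendsto
  have hV : ∀ i : Fin 4, i = 1 ∨ i = 2 → ∀ c, c = Q.loV i ∨ c = Q.hiV i →
      Tendsto (fun k => faceIntegral Q.loV Q.hiV i c fun z =>
        |(s k).w z - bc.w z| ^ 2 + |(s k).φ z - bc.φ z| ^ 2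
        + |((s k).j₁ z + (s k).j₂ z) - (bc.j₁ z + bc.j₂ z)| ^ 2
        + |((s k).j₂ z - (s k).j₁ z) - (bc.j₂ z - bc.j₁ z)| ^ 2) atTop (𝓝 0) := by
    intro i hi c hc
    have tr : ∀ {u g : (Fin 4 → ℝ) → ℝ}, HasLateralTrace Q.loV Q.hiV u g →
        HasFaceTrace Q.loV Q.hiV i c u fun y => g (onPlane i c y) := by
      intro u g hg
      rcases hc with rfl | rfl
      exacts [(hg i hi).1, (hg i hi).2]
    have hφ := h.φ.trace (Q.loV_lt_hiV i) hc (tr hbc.φ)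
    have hj₁ := h.j₁.trace (Q.loV_lt_hiV i) hc (tr hbc.j₁)
    have hj₂ := h.j₂.trace (Q.loV_lt_hiV i) hc (tr hbc.j₂)
    have hw := h.w.trace (Q.loV_lt_hiV i) hc (tr hbc.w)
    have h2 := hw.tendsto_weighted_sum hφ (hj₁.add hj₂) (hj₂.sub hj₁) 1 1
    simpa only [faceIntegral, sq_abs, add_sub_add_comm, sub_sub_sub_comm, one_mul, ← add_assoc]
      using h2
  have h3 := (((hρ 1 (Or.inl rfl) _ (Or.inl rfl)).add (hρ 1 (Or.inl rfl) _ (Or.inr rfl))).add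
    (hρ 2 (Or.inr rfl) _ (Or.inl rfl))).add (hρ 2 (Or.inr rfl) _ (Or.inr rfl))
  have h4 := (((hV 1 (Or.inl rfl) _ (Or.inl rfl)).add (hV 1 (Or.inl rfl) _ (Or.inr rfl))).add
    (hV 2 (Or.inr rfl) _ (Or.inl rfl))).add (hV 2 (Or.inr rfl) _ (Or.inr rfl))
  have := (h3.const_mul (lam₃ / lateralIntegral Q.lo Q.hi fun _ => 1)).add
    (h4.const_mul (lam₄ / lateralIntegral Q.loV Q.hiV fun _ => 1))
  simp only [mul_zero, add_zero] at this
  exact this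

theorem FieldsTendsto.lossAPNN (hε : 0 < ε) (h : FieldsTendsto Q s sol)
    (hsol : IsParitySolution Q ε sol) {ic : Fields 2} (hic : HasInitialData Q sol ic)
    {bc : Fields 3} (hbc : HasBoundaryData Q sol bc) (lam : Fin 4 → ℝ) :
    Tendsto (fun k => lossAPNN Q ε lam ic bc (s k)) atTop (𝓝 0) := by
  have := ((h.lossResidual hε hsol).add
    (h.lossInitial (ε := ε) hic (lam 0) (lam 1))).add (h.lossBoundary hbc (lam 2) (lam 3))
  simp only [add_zero] at this
  exact this

end Residuals

/-! ### The networks -/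

theorem APNNet.exists_fields_eq_of_le {m m' : ℕ} (h : m ≤ m') (A : APNNet m) :
    ∃ B : APNNet m', B.fields = A.fields := by
  obtain ⟨ρ, hρ⟩ := A.ρ.exists_eval_eq_of_le h
  obtain ⟨φ, hφ⟩ := A.φ.exists_eval_eq_of_le h
  obtain ⟨j₁, hj₁⟩ := A.j₁.exists_eval_eq_of_le h
  obtain ⟨j₂, hj₂⟩ := A.j₂.exists_eval_eq_of_le h
  obtain ⟨w, hw⟩ := A.w.exists_eval_eq_of_le h
  exact ⟨⟨ρ, φ, j₁, j₂, w⟩, by simp only [APNNet.fields, hρ, hφ, hj₁, hj₂, hw]⟩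

/-- A sequence of networks of arbitrary widths can be slowed down so that the `N`-th network
has width `N`. -/
theorem exists_net_of_width {m : ℕ → ℕ} (A : ∀ k, APNNet (m k)) {L : Fields 3 → ℝ}
    (hL : Tendsto (fun k => L (A k).fields) atTop (𝓝 0)) :
    ∃ net : (N : ℕ) → APNNet N, Tendsto (fun N => L (net N).fields) atTop (𝓝 0) := by
  -- `κ N` is the largest index `k ≤ N` whose network fits into width `N`. The default value 0 of
  -- `Nat.findGreatest` is a valid index only when `m 0 ≤ N`; for smaller `N` the zero network is
  -- used, without effect on the limit.
  set κ : ℕ → ℕ := fun N => Nat.findGreatest (fun k => m k ≤ N) N with hκ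
  have hnet : ∀ N, ∃ B : APNNet N, m 0 ≤ N → B.fields = (A (κ N)).fields := by
    intro N
    by_cases hN : m 0 ≤ N
    · have hle : m (κ N) ≤ N :=
        Nat.findGreatest_spec (P := fun k => m k ≤ N) (Nat.zero_le N) hN
      obtain ⟨B, hB⟩ := (A (κ N)).exists_fields_eq_of_le hle
      exact ⟨B, fun _ => hB⟩
    · exact ⟨⟨.zero _ _, .zero _ _, .zero _ _, .zero _ _, .zero _ _⟩, fun h => absurd h hN⟩
  choose net hnet using hnet
  have hκ' : Tendsto κ atTop atTop := tendsto_atTop.2 fun k => by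
    filter_upwards [eventually_ge_atTop (max k (m k))] with N hN
    exact Nat.le_findGreatest ((le_max_left _ _).trans hN) ((le_max_right _ _).trans hN)
  refine ⟨net, (hL.comp hκ').congr' ?_⟩
  filter_upwards [eventually_ge_atTop (m 0)] with N hN
  simp only [Function.comp, hnet N hN]

/-- The five components are approximated independently, then padded to the sum of their widths so
that they share one. -/
theorem exists_apnn_tendsto {Q : Domain} {sol : Fields 3} (h : IsH2 Q sol) :
    ∃ (m : ℕ → ℕ) (A : ∀ k, APNNet (m k)), FieldsTendsto Q (fun k => (A k).fields) sol := by
  obtain ⟨m₀, ρ, hρ⟩ := exists_nets_H1Tendsto (Φ := id) Q.lo_lt_hi contDiff_id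
    (fun j k => ⟨_, j, contDiff_cosMode₁, fun z => rfl⟩) h.ρ
  have hV := fun {u : (Fin 4 → ℝ) → ℝ} (hu : MemH Q.kinetic₄ 2 u) =>
    exists_nets_H1Tendsto Q.loV_lt_hiV contDiff_withVelocity Q.exists_feature hu
  obtain ⟨m₁, φ, hφ⟩ := hV h.φ
  obtain ⟨m₂, j₁, hj₁⟩ := hV h.j₁
  obtain ⟨m₃, j₂, hj₂⟩ := hV h.j₂
  obtain ⟨m₄, w, hw⟩ := hV h.w
  obtain ⟨m, hm⟩ : ∃ m : ℕ → ℕ, ∀ k, m k = m₀ k + m₁ k + m₂ k + m₃ k + m₄ k := ⟨_, fun _ => rfl⟩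
  choose ρ' hρ' using fun k => (ρ k).exists_eval_eq_of_le (show m₀ k ≤ m k by have := hm k; omega)
  choose φ' hφ' using fun k => (φ k).exists_eval_eq_of_le (show m₁ k ≤ m k by have := hm k; omega)
  choose j₁' hj₁' using fun k => (j₁ k).exists_eval_eq_of_le (show m₂ k ≤ m k by have := hm k; omega)
  choose j₂' hj₂' using fun k => (j₂ k).exists_eval_eq_of_le (show m₃ k ≤ m k by have := hm k; omega)
  choose w' hw' using fun k => (w k).exists_eval_eq_of_le (show m₄ k ≤ m k by have := hm k; omega)
  refine ⟨m, fun k => ⟨ρ' k, φ' k, j₁' k, j₂' k, w' k⟩, ⟨?_, ?_, ?_, ?_, ?_⟩⟩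
  · simpa only [APNNet.fields, hρ', id] using hρ
  · simpa only [APNNet.fields, hφ'] using hφ
  · simpa only [APNNet.fields, hj₁'] using hj₁
  · simpa only [APNNet.fields, hj₂'] using hj₂
  · simpa only [APNNet.fields, hw'] using hw

end ParityAPNN

open ParityAPNN
theorem mainTheorem7 :
    ∃ width : ℕ → ℕ, ∀ (Q : Domain) (ε : ℝ) (lam : Fin 4 → ℝ)
      (sol : Fields 3) (ic : Fields 2) (bc : Fields 3),
      0 < ε → IsH2 Q sol → IsParitySolution Q ε sol →
      HasInitialData Q sol ic → HasBoundaryData Q sol bc →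
      ∃ net : (N : ℕ) → APNNet (width N),
        Tendsto (fun N => lossAPNN Q ε lam ic bc (net N).fields) atTop (𝓝 0) := by
  -- Width `N` serves all domains, parameters and solutions at once; only the rate of convergence
  -- depends on them.
  refine ⟨id, fun Q ε lam sol ic bc hε h2 hsol hic hbc => ?_⟩
  obtain ⟨m, A, hA⟩ := exists_apnn_tendsto h2
  exact exists_net_of_width A (hA.lossAPNN hε hsol hic hbc lam)
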